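/- **Setting.** Let $D(z)=\log|z|\arg(1-z)-\operatorname{Im}\int_0^z\frac{\log(1-t)}{t}\,dt$ be the Bloch–Wigner function (with $D=0$ at $0$ and $1$). Let $\langle z,w\rangle=w^*Jz$ be the Hermitian form on $\mathbb C^3$ with $J=\begin{pmatrix}0&0&1\\0&1&0\\1&0&0\end{pmatrix}$, let $S^3\subset\mathbb CP^2$ be the set of its null lines (the boundary of the complex hyperbolic plane), and let $PU(2,1)$ be the projectivization of the unitary group $U(2,1)$ of the form, acting on $S^3$. A $\mathbb C$-circle is the boundary of a complex line of the complex hyperbolic plane. Four points of $S^3$ are *generic* if they are pairwise distinct and no three of them lie on a $\mathbb C$-circle. Cartan's angular invariant is $\mathbb A(p_1,p_2,p_3)=\arg(-\langle\hat p_1,\hat p_2\rangle\langle\hat p_2,\hat p_3\rangle\langle\hat p_3,\hat p_1\rangle)$ for any lifts $\hat p_i$ of $p_i$. For a generic configuration $(p_1,p_2,p_3,p_4)$ and an even permutation $(i,j,k,l)$ of $(1,2,3,4)$, let $z_{ij}$ be the cross-ratio $X(t_i,t_j,t_k,t_l)$, normalised by $X(\infty,0,1,z)=z$, in the projective line of complex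 lines through $p_i$, where $t_i$ is the complex line tangent to $S^3$ at $p_i$ and $t_j,t_k,t_l$ are the complex lines through $p_i$ and $p_j,p_k,p_l$ respectively. Put $\mathcal D([p_1,p_2,p_3,p_4])=D(z_{12})+D(z_{21})+D(z_{34})+D(z_{43})$. Fix a base point $o\in S^3$ and define, for elements $g_i\in PU(2,1)$, $$c_2(g_1,g_2,g_3)=\tfrac12 D\bigl(-e^{2i\mathbb A(g_1o,\,g_2o,\,g_3o)}\bigr),\qquad \mathcal D(g_1,g_2,g_3,g_4)=\mathcal D([g_1o,g_2o,g_3o,g_4o]),$$ the latter where $(g_1o,g_2o,g_3o,g_4o)$ is generic. **Proposition.** 1. $\partial c_2=\mathcal D$, that is, for all $g_1,\dots,g_4\in PU(2,1)$ for which $(g_1o,g_2o,g_3o,g_4o)$ is generic, $$c_2(g_2,g_3,g_4)-c_2(g_1,g_3,g_4)+c_2(g_1,g_2,g_4)-c_2(g_1,g_2,g_3)=\mathcal D(g_1,g_2,g_3,g_4).$$ 2. For the invariants $z_{ij}$ of every generic configuration of four points of $S^3$, $$D(z_{21}z_{41}z_{31})+D(z_{12}z_{32}z_{42})+D(z_{13}z_{23}z_{43})+D(z_{14}z_{24}z_{34})=2\bigl(D(z_{12})+D(z_{21})+D(z_{34})+D(z_{43})\bigr).$$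 3. The same identity holds for all families $z_{ij}\in\mathbb C\setminus\{0,1\}$ ($1\le i\ne j\le4$) that satisfy the CR constraints: for every even permutation $(i,j,k,l)$ of $(1,2,3,4)$, $z_{ik}=\dfrac1{1-z_{ij}}$ and $z_{ij}z_{ji}=\overline{z_{kl}z_{lk}}$. -/

import Mathlib

open scoped LinearAlgebra.Projectivization

noncomputable section

namespace SphericalCR

/-! ### The Bloch-Wigner dilogarithm -/

/-- The Bloch-Wigner function
`D(z) = log|z| arg(1-z) - Im ∫₀ᶻ log(1-t)/t dt`, the integral being taken along the segment
`t = s z`, `0 ≤ s ≤ 1`. The value is `0` at every real `z`, in particular at `0` and at `1`; at a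
real `z > 1` the principal branches used for `arg (1-z)` and for `log (1-t)` agree. -/
def blochWigner (z : ℂ) : ℝ :=
  Real.log ‖z‖ * (1 - z).arg - (∫ s in (0 : ℝ)..1, Complex.log (1 - s * z) / s).im

/-! ### The Hermitian form, the sphere and its automorphism group -/

/-- The Hermitian matrix of signature `(2,1)`. -/
def J : Matrix (Fin 3) (Fin 3) ℂ := !![0, 0, 1; 0, 1, 0; 1, 0, 0]

/-- The Hermitian form `⟨z, w⟩ = w^* J z`. -/
def herm (z w : Fin 3 → ℂ) : ℂ := star w ⬝ᵥ (J.mulVec z)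

/-- The sphere `S³` as the set of null lines in `ℂP²`, the boundary of the complex hyperbolic
plane. -/
abbrev S3 : Type := {p : ℙ ℂ (Fin 3 → ℂ) // herm p.rep p.rep = 0}

/-- The unitary group `U(2,1)` of the Hermitian form. -/
def U21 : Subgroup (GL (Fin 3) ℂ) where
  carrier := {g | (g : Matrix (Fin 3) (Fin 3) ℂ).conjTranspose * J * (g : Matrix _ _ ℂ) = J}
  one_mem' := by simp
  mul_mem' := by
    intro a b ha hb
    simp only [Set.mem_ofPred_eq] at ha hb ⊢
    rw [Units.val_mul, Matrix.conjTranspose_mul]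
    calc _ = (b : Matrix (Fin 3) (Fin 3) ℂ).conjTranspose *
        ((a : Matrix (Fin 3) (Fin 3) ℂ).conjTranspose * J * (a : Matrix _ _ ℂ)) *
          (b : Matrix _ _ ℂ) := by simp only [Matrix.mul_assoc]
      _ = J := by rw [ha, hb]
  inv_mem' := by
    intro a ha
    simp only [Set.mem_ofPred_eq] at ha ⊢
    have h1 : (a : Matrix (Fin 3) (Fin 3) ℂ) * ((a⁻¹ : GL (Fin 3) ℂ) : Matrix _ _ ℂ) = 1 := by
      rw [← Units.val_mul]; simp
    have h2 : ((a⁻¹ : GL (Fin 3) ℂ) : Matrix (Fin 3) (Fin 3) ℂ).conjTranspose *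
        (a : Matrix (Fin 3) (Fin 3) ℂ).conjTranspose = 1 := by
      rw [← Matrix.conjTranspose_mul, h1, Matrix.conjTranspose_one]
    calc _ = ((a⁻¹ : GL (Fin 3) ℂ) : Matrix (Fin 3) (Fin 3) ℂ).conjTranspose *
        ((a : Matrix (Fin 3) (Fin 3) ℂ).conjTranspose * J * (a : Matrix _ _ ℂ)) *
          ((a⁻¹ : GL (Fin 3) ℂ) : Matrix _ _ ℂ) := by rw [ha]
      _ = (((a⁻¹ : GL (Fin 3) ℂ) : Matrix (Fin 3) (Fin 3) ℂ).conjTranspose *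
        (a : Matrix (Fin 3) (Fin 3) ℂ).conjTranspose) * J *
          ((a : Matrix _ _ ℂ) * ((a⁻¹ : GL (Fin 3) ℂ) : Matrix _ _ ℂ)) := by
            simp only [Matrix.mul_assoc]
      _ = J := by rw [h1, h2]; simp

/-- The group `PU(2,1)`, the image of `U(2,1)` in `PGL(3,ℂ)`. -/
def PU21 : Subgroup (Matrix.ProjGenLinGroup (Fin 3) ℂ) := U21.map Matrix.ProjGenLinGroup.mk

theorem herm_smul_smul (a b : ℂ) (z w : Fin 3 → ℂ) :
    herm (a • z) (b • w) = a * star b * herm z w := by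
  simp only [herm, star_smul, Matrix.mulVec_smul, smul_dotProduct, dotProduct_smul, smul_eq_mul]
  ring

theorem herm_rep_mk (v : Fin 3 → ℂ) (hv : v ≠ 0) :
    herm (Projectivization.mk ℂ v hv).rep (Projectivization.mk ℂ v hv).rep = 0 ↔
      herm v v = 0 := by
  obtain ⟨a, ha⟩ := Projectivization.exists_smul_eq_mk_rep ℂ v hv
  rw [← ha, Units.smul_def, herm_smul_smul]
  simp

theorem herm_mulVec {g : GL (Fin 3) ℂ} (hg : g ∈ U21) (z w : Fin 3 → ℂ) :
    herm ((g : Matrix (Fin 3) (Fin 3) ℂ).mulVec z) ((g : Matrix _ _ ℂ).mulVec w) = herm z w := by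
  have hg' : (g : Matrix (Fin 3) (Fin 3) ℂ).conjTranspose * J * (g : Matrix _ _ ℂ) = J := hg
  conv_rhs => rw [herm, ← hg']
  rw [herm, Matrix.star_mulVec, ← Matrix.dotProduct_mulVec, Matrix.mulVec_mulVec,
    Matrix.mulVec_mulVec, Matrix.mul_assoc]

theorem smul_mem_S3 (g : PU21) (p : S3) : herm (g • p.1).rep (g • p.1).rep = 0 := by
  obtain ⟨g, u, hu, rfl⟩ := g
  obtain ⟨p, hp⟩ := p
  induction p using Projectivization.ind with
  | h v hv =>
    have hu' : u ∈ U21 := hu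
    rw [herm_rep_mk] at hp
    exact (herm_rep_mk (u • v) ((smul_ne_zero_iff_ne u).mpr hv)).2 ((herm_mulVec hu' v v).trans hp)

/-- The action of `PU(2,1)` on `S³` by CR transformations. -/
instance : MulAction PU21 S3 where
  smul g p := ⟨g • p.1, smul_mem_S3 g p⟩
  one_smul p := Subtype.ext (one_smul PU21 p.1)
  mul_smul g h p := Subtype.ext (mul_smul g h p.1)

/-- A `ℂ`-circle: the boundary of a complex line of the complex hyperbolic plane, i.e. the trace
on `S³` of the projective line given by a plane of `ℂ³` that contains a negative vector. -/
def IsCCircle (C : Set S3) : Prop :=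
  ∃ W : Submodule ℂ (Fin 3 → ℂ), Module.finrank ℂ W = 2 ∧ (∃ w ∈ W, (herm w w).re < 0) ∧
    C = {p : S3 | p.1.rep ∈ W}

/-- A generic configuration of four points of `S³`: the points are pairwise distinct, and no three
of them lie on a `ℂ`-circle. -/
def IsGeneric (p : Fin 4 → S3) : Prop :=
  Function.Injective p ∧
    ∀ C : Set S3, IsCCircle C → ∀ i j k : Fin 4, i ≠ j → i ≠ k → j ≠ k →
      ¬ (p i ∈ C ∧ p j ∈ C ∧ p k ∈ C)

/-- Cartan's angular invariant
`𝔸(p₁,p₂,p₃) = arg(-⟨p₁,p₂⟩⟨p₂,p₃⟩⟨p₃,p₁⟩)`. It does not depend on the lifts. -/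
def cartan (p₁ p₂ p₃ : S3) : ℝ :=
  (-(herm p₁.1.rep p₂.1.rep * herm p₂.1.rep p₃.1.rep * herm p₃.1.rep p₁.1.rep)).arg

/-! ### Cross-ratios of four points of the sphere -/

/-- The cross-ratio of four complex lines through the point `[p]` of `ℂP²`, which are spanned by
`p` together with `a`, `b`, `c`, `d` respectively. It is the usual cross-ratio, with
`X(∞,0,1,z) = z`, of four points in the projective line `ℙ(ℂ³/ℂp)`; here
`(x, y) ↦ det (p, x, y)` is the area form of `ℂ³/ℂp`. -/
def lineCrossRatio (p a b c d : Fin 3 → ℂ) : ℂ :=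
  (Matrix.of ![p, d, b]).det * (Matrix.of ![p, c, a]).det /
    ((Matrix.of ![p, c, b]).det * (Matrix.of ![p, d, a]).det)

/-- The point `[v]` and a second point span the complex line tangent to `S³` at `[v]`. -/
theorem exists_tangent (v : Fin 3 → ℂ) :
    ∃ u : Fin 3 → ℂ, herm u v = 0 ∧ u ∉ Submodule.span ℂ {v} := by
  by_contra! h
  let φ : (Fin 3 → ℂ) →ₗ[ℂ] ℂ :=
    { toFun := fun u => herm u v
      map_add' := by intro x y; simp [herm, Matrix.mulVec_add, dotProduct_add]
      map_smul' := by intro a x; simp [herm, Matrix.mulVec_smul, dotProduct_smul] }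
  have h1 := φ.finrank_range_add_finrank_ker
  have h2 : Module.finrank ℂ (LinearMap.range φ) ≤ 1 := by
    simpa using Submodule.finrank_le (LinearMap.range φ)
  have h3 : Module.finrank ℂ (LinearMap.ker φ) ≤ 1 :=
    (Submodule.finrank_mono (show LinearMap.ker φ ≤ Submodule.span ℂ {v} from h)).trans
      ((finrank_span_le_card {v}).trans (by simp))
  simp at h1
  omega

theorem exists_det_eq_mul_herm (v u : Fin 3 → ℂ) (hv : herm v v = 0) (hu : herm u v = 0)
    (huv : u ∉ Submodule.span ℂ {v}) (hv0 : v ≠ 0) :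
    ∃ κ : ℂ, κ ≠ 0 ∧ ∀ x, (Matrix.of ![v, x, u]).det = κ * herm x v := by
  simp only [herm, J, Matrix.mulVec, dotProduct, Fin.sum_univ_three, Matrix.of_apply,
    Matrix.cons_val', Matrix.cons_val_zero, Matrix.cons_val_one, Matrix.cons_val, Pi.star_apply,
    zero_mul, one_mul, zero_add, add_zero] at hv hu ⊢
  have hc : star (v 2) ≠ 0 ∨ star (v 1) ≠ 0 ∨ star (v 0) ≠ 0 := by
    by_contra! h
    simp only [star_eq_zero] at h
    exact hv0 (by ext i; fin_cases i <;> simp [h])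
  have hw : v 2 * u 1 - v 1 * u 2 ≠ 0 ∨ v 0 * u 2 - v 2 * u 0 ≠ 0 ∨
      v 1 * u 0 - v 0 * u 1 ≠ 0 := by
    by_contra! h
    obtain ⟨h0, h1, h2⟩ := h
    apply huv
    rw [Submodule.mem_span_singleton]
    by_cases a0 : v 0 = 0
    · by_cases a1 : v 1 = 0
      · have a2 : v 2 ≠ 0 := fun a2 => hv0 (by ext i; fin_cases i <;> simp [*])
        refine ⟨u 2 / v 2, ?_⟩
        ext i; fin_cases i <;> simp <;> field_simp <;> grind
      · refine ⟨u 1 / v 1, ?_⟩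
        ext i; fin_cases i <;> simp <;> field_simp <;> grind
    · refine ⟨u 0 / v 0, ?_⟩
      ext i; fin_cases i <;> simp <;> field_simp <;> grind
  simp only [Matrix.det_fin_three, Matrix.of_apply, Matrix.cons_val', Matrix.cons_val_zero,
    Matrix.cons_val_one, Matrix.cons_val]
  generalize star (v 0) = c2 at *
  generalize star (v 1) = c1 at *
  generalize star (v 2) = c0 at *
  have e01 : (v 2 * u 1 - v 1 * u 2) * c1 = (v 0 * u 2 - v 2 * u 0) * c0 := by
    linear_combination (v 2) * hu - (u 2) * hv
  have e12 : (v 0 * u 2 - v 2 * u 0) * c2 = (v 1 * u 0 - v 0 * u 1) * c1 := by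
    linear_combination (v 0) * hu - (u 0) * hv
  have e02 : (v 2 * u 1 - v 1 * u 2) * c2 = (v 1 * u 0 - v 0 * u 1) * c0 := by
    linear_combination (u 1) * hv - (v 1) * hu
  suffices h : ∃ κ : ℂ, κ ≠ 0 ∧ v 2 * u 1 - v 1 * u 2 = κ * c0 ∧
      v 0 * u 2 - v 2 * u 0 = κ * c1 ∧ v 1 * u 0 - v 0 * u 1 = κ * c2 by
    obtain ⟨κ, hκ, h0, h1, h2⟩ := h
    exact ⟨κ, hκ, fun x => by linear_combination x 0 * h0 + x 1 * h1 + x 2 * h2⟩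
  generalize v 2 * u 1 - v 1 * u 2 = A at *
  generalize v 0 * u 2 - v 2 * u 0 = B at *
  generalize v 1 * u 0 - v 0 * u 1 = C at *
  rcases hc with h | h | h
  · refine ⟨A / c0, ?_, ?_, ?_, ?_⟩ <;> field_simp <;> grind
  · refine ⟨B / c1, ?_, ?_, ?_, ?_⟩ <;> field_simp <;> grind
  · refine ⟨C / c2, ?_, ?_, ?_, ?_⟩ <;> field_simp <;> grind

/-- A vector that, together with the lift of `p`, spans the complex line tangent to `S³` at `p`,
i.e. the plane orthogonal to `p`. -/
def tangentVec (p : S3) : Fin 3 → ℂ := Classical.choose (exists_tangent p.1.rep)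

/-- The CR cross-ratio invariant `(p₁,p₂,p₃,p₄)`: the cross-ratio of the four complex lines through
`p₁` of which the first one is tangent to `S³` and the other ones contain `p₂`, `p₃`, `p₄`. -/
def invariant (p₁ p₂ p₃ p₄ : S3) : ℂ :=
  lineCrossRatio p₁.1.rep (tangentVec p₁) p₂.1.rep p₃.1.rep p₄.1.rep

/-- The tangent line may be replaced by the form `⟨·, p₁⟩` that vanishes on it; in particular the
choice of the tangent vector is irrelevant. -/
theorem invariant_eq (p₁ p₂ p₃ p₄ : S3) :
    invariant p₁ p₂ p₃ p₄ =
      (Matrix.of ![p₁.1.rep, p₄.1.rep, p₂.1.rep]).det * herm p₃.1.rep p₁.1.rep /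
        ((Matrix.of ![p₁.1.rep, p₃.1.rep, p₂.1.rep]).det * herm p₄.1.rep p₁.1.rep) := by
  obtain ⟨κ, hκ, h⟩ := exists_det_eq_mul_herm p₁.1.rep (tangentVec p₁) p₁.2
    (Classical.choose_spec (exists_tangent p₁.1.rep)).1
    (Classical.choose_spec (exists_tangent p₁.1.rep)).2 p₁.1.rep_nonzero
  rw [invariant, lineCrossRatio, h, h]
  rw [mul_left_comm, mul_left_comm _ κ, mul_div_mul_left _ _ hκ]

/-- The twelve invariants `z_{ij} = (p_i,p_j,p_k,p_l)`, `(i,j,k,l)` an even permutation, of four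
points (indexed from `0`); the diagonal entries are irrelevant. -/
def edgeInvariant (p : Fin 4 → S3) : Fin 4 → Fin 4 → ℂ
  | 0, 1 => invariant (p 0) (p 1) (p 2) (p 3)
  | 0, 2 => invariant (p 0) (p 2) (p 3) (p 1)
  | 0, 3 => invariant (p 0) (p 3) (p 1) (p 2)
  | 1, 0 => invariant (p 1) (p 0) (p 3) (p 2)
  | 1, 3 => invariant (p 1) (p 3) (p 2) (p 0)
  | 1, 2 => invariant (p 1) (p 2) (p 0) (p 3)
  | 2, 3 => invariant (p 2) (p 3) (p 0) (p 1)
  | 2, 0 => invariant (p 2) (p 0) (p 1) (p 3)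
  | 2, 1 => invariant (p 2) (p 1) (p 3) (p 0)
  | 3, 2 => invariant (p 3) (p 2) (p 1) (p 0)
  | 3, 1 => invariant (p 3) (p 1) (p 0) (p 2)
  | 3, 0 => invariant (p 3) (p 0) (p 2) (p 1)
  | _, _ => 0

/-- The volume `𝒟(z) = D(z₁₂) + D(z₂₁) + D(z₃₄) + D(z₄₃)` (indices from `0`). -/
def volume (z : Fin 4 → Fin 4 → ℂ) : ℝ :=
  blochWigner (z 0 1) + blochWigner (z 1 0) + blochWigner (z 2 3) + blochWigner (z 3 2)

/-- Cross-ratio structures on four points that satisfy the CR constraints: the `z_{ij}`, `i ≠ j`,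
lie in `ℂ ∖ {0,1}`, and for every even permutation `(i,j,k,l)` the similarity relation
`z_{ik} = 1/(1 - z_{ij})` and the CR equation `z_{ij} z_{ji} = conj (z_{kl} z_{lk})` hold. -/
structure IsCRCrossRatio (z : Fin 4 → Fin 4 → ℂ) : Prop where
  ne_zero : ∀ i j, i ≠ j → z i j ≠ 0
  ne_one : ∀ i j, i ≠ j → z i j ≠ 1
  similarity : ∀ σ : Equiv.Perm (Fin 4), Equiv.Perm.sign σ = 1 →
    z (σ 0) (σ 2) = 1 / (1 - z (σ 0) (σ 1))
  cr : ∀ σ : Equiv.Perm (Fin 4), Equiv.Perm.sign σ = 1 →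
    z (σ 0) (σ 1) * z (σ 1) (σ 0) = star (z (σ 2) (σ 3) * z (σ 3) (σ 2))

/-! ### Cochains -/

/-- The coboundary of a homogeneous cochain:
`(∂c)(g₁,…,g_{n+1}) = ∑ᵢ (-1)^{i+1} c(g₁,…,ĝᵢ,…,g_{n+1})`. -/
def coboundary {G : Type*} {n : ℕ} (c : (Fin n → G) → ℝ) (g : Fin (n + 1) → G) : ℝ :=
  ∑ i : Fin (n + 1), (-1) ^ (i : ℕ) * c (fun k => g (i.succAbove k))

/-- The `2`-cochain `c₂(g₁,g₂,g₃) = ½ D(-exp(2i 𝔸(g₁o,g₂o,g₃o)))` with base point `o`. -/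
def c₂ (o : S3) (g : Fin 3 → PU21) : ℝ :=
  1 / 2 * blochWigner
    (-Complex.exp (2 * Complex.I * (cartan (g 0 • o) (g 1 • o) (g 2 • o) : ℂ)))

/-- The volume `3`-cochain `𝒟(g₁,…,g₄) = 𝒟([g₁o,g₂o,g₃o,g₄o])` with base point `o`. -/
def volumeCochain (o : S3) (g : Fin 4 → PU21) : ℝ :=
  volume (edgeInvariant fun i => g i • o)

end SphericalCR

end

open SphericalCR

open scoped LinearAlgebra.Projectivization

noncomputable section

namespace SphericalCR

section

open Complex MeasureTheory Set Topology

/-! ### The dilogarithm integral -/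

/-! The third part carries the others. A generic configuration satisfies the CR constraints
(`IsGeneric.isCRCrossRatio`): `z_ij z_ji` is a cross-ratio of Hermitian products, which is
conjugated when the two pairs of points are exchanged, and the similarity relation is a linear
identity between determinants through a null vector. This gives the second part. In the product of
the three invariants pointing at one vertex all determinants cancel, and what is left is `-exp(2i𝔸)`
of the opposite triangle. Reversing a triangle conjugates this number and changes the sign of `D`,
so the sum over the vertices becomes the alternating sum of the coboundary; the factor `1/2` in `c₂`
absorbs the `2` of the identity.

For the third part, similarity leaves four parameters, one at each vertex: `x, y, s, t` for `z 0 1,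
z 1 0, z 2 3, z 3 2`. The CR equations of the other two pairs of opposite edges are linear enough to
give `s` and `t` as rational functions of `x, y` and their conjugates, unless `y` is the conjugate
of `x`, when both sides cancel in conjugate pairs. The identity is then a functional equation for
`D`. If `xy` is real, one five-term relation suffices. Otherwise it is a combination of six
five-term relations, for `∞` and four points among `0`, `1`, `x` and three auxiliary ones
(`five_term_pencil_a` to `five_term_pencil_d`, two of them used again with `x` and `y` exchanged).
The surplus terms cancel by the symmetries of `D` under `z ↦ 1/z`, `1 - z` and conjugation.

The functional equations of `D` come from `dD = log|z| d arg(1-z) - log|1-z| d arg z`: each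
combination has zero differential off a finite set, hence is constant there, and `D` vanishes on the
real line. -/

theorem one_sub_mul_mem_slitPlane {z : ℂ} (hz : 1 - z ∈ slitPlane) {s : ℝ} (h0 : 0 ≤ s)
    (h1 : s ≤ 1) : 1 - (s : ℂ) * z ∈ slitPlane := by
  have := starConvex_one_slitPlane hz (sub_nonneg.2 h1) h0 (by ring)
  convert this using 1
  simp only [real_smul, ofReal_sub, ofReal_one]
  ring

theorem hasDerivAt_log_one_sub_mul {z : ℂ} {s : ℝ} (h : 1 - (s : ℂ) * z ∈ slitPlane) :
    HasDerivAt (fun s : ℝ => log (1 - s * z)) (-z / (1 - s * z)) s := by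
  have h1 : HasDerivAt (fun s : ℝ => 1 - (s : ℂ) * z) (-z) s := by
    simpa using ((hasDerivAt_id s).ofReal_comp.mul_const z).const_sub 1
  exact h1.clog_real h

/-- The singularity at `s = 0` is removable: on the open interval the integrand is the difference
quotient at `0` of `s ↦ log (1 - s z)`, which extends continuously by the derivative. -/
theorem intervalIntegrable_log_div {z : ℂ} {b : ℝ} (hb : 0 ≤ b)
    (h : ∀ s : ℝ, 0 ≤ s → s ≤ b → 1 - (s : ℂ) * z ∈ slitPlane) :
    IntervalIntegrable (fun s : ℝ => log (1 - s * z) / s) MeasureTheory.volume 0 b := by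
  have hd : ContinuousOn (dslope (fun s : ℝ => log (1 - s * z)) 0) (uIcc 0 b) := by
    intro s hs
    rw [uIcc_of_le hb] at hs
    have hs' := hasDerivAt_log_one_sub_mul (h s hs.1 hs.2)
    have h0 := hasDerivAt_log_one_sub_mul (h 0 le_rfl hb)
    apply ContinuousAt.continuousWithinAt
    by_cases hs0 : s = 0
    · subst hs0
      exact continuousAt_dslope_same.2 h0.differentiableAt
    · exact (continuousAt_dslope_of_ne hs0).2 hs'.continuousAt
  refine (hd.intervalIntegrable).congr ?_
  intro s hs
  rw [uIoc_of_le hb] at hs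
  rw [dslope_of_ne _ hs.1.ne', slope_def_module]
  simp [div_eq_inv_mul]

theorem integral_inv_one_sub_mul {z : ℂ} (hz : 1 - z ∈ slitPlane) (hz0 : z ≠ 0) :
    ∫ s in (0 : ℝ)..1, -1 / (1 - (s : ℂ) * z) = log (1 - z) / z := by
  have hne : ∀ s ∈ uIcc (0 : ℝ) 1, 1 - (s : ℂ) * z ∈ slitPlane := by
    intro s hs
    rw [uIcc_of_le zero_le_one] at hs
    exact one_sub_mul_mem_slitPlane hz hs.1 hs.2
  rw [intervalIntegral.integral_eq_sub_of_hasDerivAt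
    (f := fun s : ℝ => log (1 - s * z) / z)]
  · simp
  · intro s hs
    have h := (hasDerivAt_log_one_sub_mul (hne s hs)).div_const z
    rwa [div_right_comm, neg_div, div_self hz0] at h
  · apply ContinuousOn.intervalIntegrable
    intro s hs
    apply ContinuousAt.continuousWithinAt
    have := slitPlane_ne_zero (hne s hs)
    fun_prop (disch := assumption)

/-- Differentiation under the integral sign: the factor `1/s` cancels, and `-1/(1 - s w)` is bounded
for `s ∈ [0,1]` and `w` in a small closed ball, by compactness. -/
theorem hasDerivAt_dilogIntegral {z : ℂ} (hz : 1 - z ∈ slitPlane) (hz0 : z ≠ 0) :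
    HasDerivAt (fun z : ℂ => ∫ s in (0 : ℝ)..1, log (1 - s * z) / s) (log (1 - z) / z) z := by
  rw [← integral_inv_one_sub_mul hz hz0]
  have hopen : IsOpen {w : ℂ | 1 - w ∈ slitPlane} :=
    isOpen_slitPlane.preimage (by fun_prop)
  obtain ⟨ε, hε, hball⟩ := Metric.nhds_basis_closedBall.mem_iff.1 (hopen.mem_nhds hz)
  have hcpt : IsCompact (Icc (0 : ℝ) 1 ×ˢ Metric.closedBall z ε) :=
    isCompact_Icc.prod (isCompact_closedBall z ε)
  have hmem : ∀ s ∈ Icc (0 : ℝ) 1, ∀ w ∈ Metric.closedBall z ε, 1 - (s : ℂ) * w ∈ slitPlane :=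
    fun s hs w hw => one_sub_mul_mem_slitPlane (hball hw) hs.1 hs.2
  obtain ⟨C, hC⟩ := hcpt.exists_bound_of_continuousOn
    (f := fun q : ℝ × ℂ => -1 / (1 - (q.1 : ℂ) * q.2)) (by
      intro q hq
      have := slitPlane_ne_zero (hmem q.1 hq.1 q.2 hq.2)
      apply ContinuousAt.continuousWithinAt
      fun_prop (disch := assumption))
  have hIoc : ∀ s ∈ uIoc (0 : ℝ) 1, s ∈ Icc (0 : ℝ) 1 := by
    intro s hs
    rw [uIoc_of_le zero_le_one] at hs
    exact ⟨hs.1.le, hs.2⟩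
  refine (intervalIntegral.hasDerivAt_integral_of_dominated_loc_of_deriv_le
    (F := fun (w : ℂ) (s : ℝ) => log (1 - s * w) / s)
    (F' := fun (w : ℂ) (s : ℝ) => -1 / (1 - s * w)) (μ := MeasureTheory.volume)
    (s := Metric.closedBall z ε) (bound := fun _ => C) (Metric.closedBall_mem_nhds z hε)
    ?_ ?_ ?_ ?_ ?_ ?_).2
  · filter_upwards with w
    exact (by fun_prop : Measurable fun s : ℝ => log (1 - s * w) / s).aestronglyMeasurable
  · exact intervalIntegrable_log_div zero_le_one fun s h0 h1 => one_sub_mul_mem_slitPlane hz h0 h1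
  · exact (by fun_prop : Measurable fun s : ℝ => -1 / (1 - (s : ℂ) * z)).aestronglyMeasurable
  · filter_upwards with s hs w hw
    exact hC (s, w) ⟨hIoc s hs, hw⟩
  · exact intervalIntegrable_const
  · filter_upwards with s hs w hw
    have h1 : HasDerivAt (fun w : ℂ => 1 - (s : ℂ) * w) (-(s : ℂ)) w := by
      simpa using ((hasDerivAt_id w).const_mul (s : ℂ)).const_sub 1
    rw [uIoc_of_le zero_le_one] at hs
    have hs0 : (s : ℂ) ≠ 0 := ofReal_ne_zero.2 hs.1.ne'
    have h := (h1.clog (hmem s ⟨hs.1.le, hs.2⟩ w hw)).div_const (s : ℂ)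
    rwa [div_right_comm, neg_div, div_self hs0] at h

/-! ### Real arguments and complex conjugation -/

theorem log_ofReal_of_neg {x : ℝ} (hx : x < 0) : log (x : ℂ) = Real.log x + Real.pi * I := by
  apply Complex.ext <;> simp [log_re, log_im, arg_ofReal_of_neg hx]

/-- For `r ≤ 1` all logarithms are real. For `r > 1` the integrand acquires the imaginary part `π/s`
beyond `s = 1/r`; this integrates to `π log r`, which cancels `log|r| arg(1-r)`. -/
theorem blochWigner_ofReal (r : ℝ) : blochWigner r = 0 := by
  rcases le_or_gt r 1 with hr | hr
  · have h1 : (1 - (r : ℂ)).arg = 0 := by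
      rw [← ofReal_one, ← ofReal_sub, arg_ofReal_of_nonneg (sub_nonneg.2 hr)]
    have h2 : ∫ s in (0 : ℝ)..1, log (1 - s * (r : ℂ)) / s =
        ((∫ s in (0 : ℝ)..1, Real.log (1 - s * r) / s : ℝ) : ℂ) := by
      rw [← intervalIntegral.integral_ofReal]
      apply intervalIntegral.integral_congr
      intro s hs
      rw [uIcc_of_le zero_le_one] at hs
      have : 0 ≤ 1 - s * r := by nlinarith [hs.1, hs.2]
      simp only [ofReal_div, ofReal_log this, ofReal_sub, ofReal_one, ofReal_mul]
    rw [blochWigner, h1, h2, ofReal_im]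
    simp
  · have hr0 : 0 < r := by linarith
    -- The cut at `1/(2r)` separates the removable singularity at `0` from the logarithmic one at
    -- `1/r`, as they need different integrability arguments.
    have ha : 0 < 1 / (2 * r) := by positivity
    have hab : 1 / (2 * r) ≤ 1 / r := by
      apply one_div_le_one_div_of_le hr0; linarith
    have hb1 : 1 / r ≤ 1 := by rw [div_le_one hr0]; exact hr.le
    have i1 : IntervalIntegrable (fun s : ℝ => log (1 - s * (r : ℂ)) / s) MeasureTheory.volume 0
        (1 / (2 * r)) := by
      apply intervalIntegrable_log_div ha.le
      intro s _ hs
      rw [le_div_iff₀ (by positivity)] at hs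
      rw [← ofReal_one, ← ofReal_mul, ← ofReal_sub, ofReal_mem_slitPlane]
      nlinarith
    have iR : ∀ a b : ℝ, 0 < a → 0 < b →
        IntervalIntegrable (fun s : ℝ => Real.log (1 - s * r) / s) MeasureTheory.volume a b := by
      intro a b h0a h0b
      have hlog : IntervalIntegrable (fun s : ℝ => Real.log (1 - s * r))
          MeasureTheory.volume a b := by
        have h := (intervalIntegral.intervalIntegrable_log' (a := 1 - r * a)
          (b := 1 - r * b)).comp_sub_left 1
        have h' := h.comp_mul_left (c := r)
        simp only [sub_sub_cancel] at h'
        rw [mul_div_cancel_left₀ _ hr0.ne', mul_div_cancel_left₀ _ hr0.ne'] at h'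
        simpa only [mul_comm r] using h'
      simp only [div_eq_mul_inv]
      apply hlog.mul_continuousOn
      apply continuousOn_inv₀.mono
      intro s hs h0
      have := (lt_min h0a h0b).trans_le hs.1
      simp at h0; linarith
    have e2 : ∀ s ∈ uIoc (1 / (2 * r)) (1 / r), ((Real.log (1 - s * r) / s : ℝ) : ℂ) =
        log (1 - s * (r : ℂ)) / s := by
      intro s hs
      rw [uIoc_of_le hab] at hs
      have h2 := hs.2
      rw [le_div_iff₀ hr0] at h2
      rw [ofReal_div, ofReal_log (by linarith)]
      simp
    have e3 : ∀ s ∈ uIoc (1 / r) 1, ((Real.log (1 - s * r) / s : ℝ) : ℂ) +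
        ((Real.pi * s⁻¹ : ℝ) : ℂ) * I = log (1 - s * (r : ℂ)) / s := by
      intro s hs
      rw [uIoc_of_le hb1] at hs
      have h2 := hs.1
      rw [div_lt_iff₀ hr0] at h2
      have : log (1 - s * (r : ℂ)) = Real.log (1 - s * r) + Real.pi * I := by
        rw [← log_ofReal_of_neg (by linarith)]; simp
      rw [this]
      push_cast
      ring
    have toC : ∀ (f : ℝ → ℝ) (a b : ℝ), IntervalIntegrable f MeasureTheory.volume a b →
        IntervalIntegrable (fun s => (f s : ℂ)) MeasureTheory.volume a b :=
      fun f a b h => ⟨h.1.ofReal, h.2.ofReal⟩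
    have i2 := toC _ _ _ (iR (1 / (2 * r)) (1 / r) ha (ha.trans_le hab))
    have i3 := toC _ _ _ (iR (1 / r) 1 (ha.trans_le hab) one_pos)
    have i4 : IntervalIntegrable (fun s : ℝ => Real.pi * s⁻¹) MeasureTheory.volume (1 / r) 1 := by
      apply ContinuousOn.intervalIntegrable
      apply continuousOn_const.mul
      apply continuousOn_inv₀.mono
      intro s hs h0
      have := (lt_min (ha.trans_le hab) one_pos).trans_le hs.1
      simp at h0; linarith
    have i4' := (toC _ _ _ i4).mul_const I
    have j2 := i2.congr e2
    have j3 := (i3.add i4').congr e3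
    have v1 : ∫ s in (0 : ℝ)..(1 / (2 * r)), log (1 - s * (r : ℂ)) / s =
        ((∫ s in (0 : ℝ)..(1 / (2 * r)), Real.log (1 - s * r) / s : ℝ) : ℂ) := by
      rw [← intervalIntegral.integral_ofReal]
      apply intervalIntegral.integral_congr
      intro s hs
      rw [uIcc_of_le ha.le] at hs
      have h2 := hs.2
      rw [le_div_iff₀ (by positivity)] at h2
      have : 0 ≤ 1 - s * r := by nlinarith [hs.1]
      simp only [ofReal_div, ofReal_log this, ofReal_sub, ofReal_one, ofReal_mul]
    have v2 : ∫ s in (1 / (2 * r))..(1 / r), log (1 - s * (r : ℂ)) / s =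
        ((∫ s in (1 / (2 * r))..(1 / r), Real.log (1 - s * r) / s : ℝ) : ℂ) := by
      rw [← intervalIntegral.integral_ofReal]
      exact intervalIntegral.integral_congr_ae (by filter_upwards with s hs using (e2 s hs).symm)
    have v3 : ∫ s in (1 / r)..1, log (1 - s * (r : ℂ)) / s =
        ((∫ s in (1 / r)..1, Real.log (1 - s * r) / s : ℝ) : ℂ) +
          ((Real.pi * Real.log r : ℝ) : ℂ) * I := by
      have : ∫ s in (1 / r)..1, (s : ℝ)⁻¹ = Real.log r := by
        rw [integral_inv_of_pos (ha.trans_le hab) one_pos]; simp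
      rw [← this, ← intervalIntegral.integral_const_mul, ← intervalIntegral.integral_ofReal,
        ← intervalIntegral.integral_ofReal, ← intervalIntegral.integral_mul_const,
        ← intervalIntegral.integral_add i3 i4']
      exact intervalIntegral.integral_congr_ae (by filter_upwards with s hs using (e3 s hs).symm)
    rw [blochWigner, ← intervalIntegral.integral_add_adjacent_intervals i1 (j2.trans j3),
      ← intervalIntegral.integral_add_adjacent_intervals j2 j3, v1, v2, v3]
    have : (1 - (r : ℂ)).arg = Real.pi := by
      rw [← ofReal_one, ← ofReal_sub, arg_ofReal_of_neg (by linarith)]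
    rw [this]
    simp [abs_of_pos hr0]
    ring

theorem blochWigner_of_im_eq_zero {z : ℂ} (h : z.im = 0) : blochWigner z = 0 := by
  rw [← blochWigner_ofReal z.re]
  congr 1
  exact Complex.ext (by simp) (by simp [h])

theorem blochWigner_zero : blochWigner 0 = 0 := blochWigner_of_im_eq_zero rfl

theorem blochWigner_one : blochWigner 1 = 0 := blochWigner_of_im_eq_zero rfl

theorem mem_slitPlane_one_sub {z : ℂ} (h : z.im ≠ 0) : 1 - z ∈ slitPlane := by
  right; simpa using h

theorem blochWigner_conj (z : ℂ) : blochWigner (star z) = -blochWigner z := by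
  by_cases h : z.im = 0
  · rw [blochWigner_of_im_eq_zero h, blochWigner_of_im_eq_zero (by simpa using h), neg_zero]
  have harg : (1 - z).arg ≠ Real.pi := slitPlane_arg_ne_pi (mem_slitPlane_one_sub h)
  have h1 : (1 - star z).arg = -(1 - z).arg := by
    have := arg_conj (1 - z)
    rw [if_neg harg] at this
    simpa using this
  have h2 : ∫ s in (0 : ℝ)..1, log (1 - s * star z) / s =
      star (∫ s in (0 : ℝ)..1, log (1 - s * z) / s) := by
    rw [intervalIntegral.integral_of_le zero_le_one, intervalIntegral.integral_of_le zero_le_one]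
    refine Eq.trans ?_ integral_conj
    apply setIntegral_congr_fun measurableSet_Ioc
    intro s hs
    have hs' := slitPlane_arg_ne_pi
      (one_sub_mul_mem_slitPlane (mem_slitPlane_one_sub h) hs.1.le hs.2)
    have := log_conj (1 - s * z) hs'
    simp only [map_sub, map_mul, map_one, conj_ofReal] at this
    simp only [map_div₀, conj_ofReal, ← this]
    rfl
  rw [blochWigner, blochWigner, h1, h2]
  simp
  ring

/-! ### The differential of the Bloch-Wigner function -/

/-- The real linear form `v ↦ Im (c v)`. -/
def imMul (c : ℂ) : ℂ →L[ℝ] ℝ := imCLM.comp (ContinuousLinearMap.mul ℝ ℂ c)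

theorem imMul_apply (c v : ℂ) : imMul c v = (c * v).im := rfl

theorem imMul_add (c d : ℂ) : imMul c + imMul d = imMul (c + d) := by
  ext v; simp [imMul_apply]; ring

theorem imMul_neg (c : ℂ) : -imMul c = imMul (-c) := by
  ext v; simp [imMul_apply]

theorem imMul_sub (c d : ℂ) : imMul c - imMul d = imMul (c - d) := by
  rw [sub_eq_add_neg, imMul_neg, imMul_add, sub_eq_add_neg]

theorem imMul_smul (r : ℝ) (c : ℂ) : r • imMul c = imMul (r * c) := by
  ext v; simp [imMul_apply, mul_assoc]

theorem imMul_zero : imMul 0 = 0 := by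
  ext v; simp [imMul_apply]

theorem hasFDerivAt_im {f : ℂ → ℂ} {f' z : ℂ} (h : HasDerivAt f f' z) :
    HasFDerivAt (fun w => (f w).im) (imMul f') z := by
  refine (imCLM.hasFDerivAt.comp z (h.hasFDerivAt.restrictScalars ℝ)).congr_fderiv ?_
  ext v; simp [imMul_apply, mul_comm]

theorem hasFDerivAt_log_norm {z : ℂ} (hz : z ≠ 0) :
    HasFDerivAt (fun w : ℂ => Real.log ‖w‖) (imMul (I / z)) z := by
  -- Dividing by `z` moves the base point to `1`, away from the branch cut, and changes `log ‖w‖`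
  -- only by a constant.
  have h1 : HasDerivAt (fun w : ℂ => I * log (w / z)) (I / z) z := by
    have h2 : HasDerivAt (fun w : ℂ => w / z) (1 / z) z := (hasDerivAt_id z).div_const z
    have h3 : z / z ∈ slitPlane := by rw [div_self hz]; exact one_mem_slitPlane
    have h4 := (h2.clog h3).const_mul I
    rwa [div_self hz, div_one, mul_one_div] at h4
  refine ((hasFDerivAt_im h1).add_const (Real.log ‖z‖)).congr_of_eventuallyEq ?_
  filter_upwards [isOpen_ne.mem_nhds hz] with w hw
  have hw' : (w : ℂ) ≠ 0 := hw
  have : (I * log (w / z)).im = Real.log ‖w‖ - Real.log ‖z‖ := by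
    rw [I_mul_im, log_re, norm_div, Real.log_div (norm_ne_zero_iff.2 hw') (norm_ne_zero_iff.2 hz)]
  rw [this]; ring

/-- The coefficient `c` of the differential `v ↦ Im (c v)` of the Bloch-Wigner function. -/
def blochWignerDeriv (z : ℂ) : ℂ :=
  -(Real.log ‖z‖ : ℂ) / (1 - z) - (Real.log ‖1 - z‖ : ℂ) / z

theorem hasFDerivAt_blochWigner_of_slitPlane {z : ℂ} (hz : 1 - z ∈ slitPlane) (hz0 : z ≠ 0) :
    HasFDerivAt blochWigner (imMul (blochWignerDeriv z)) z := by
  have h1 : HasDerivAt (fun w : ℂ => log (1 - w)) (-1 / (1 - z)) z :=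
    ((hasDerivAt_id z).const_sub 1).clog hz
  have h := ((hasFDerivAt_log_norm hz0).mul (hasFDerivAt_im h1)).sub
    (hasFDerivAt_im (hasDerivAt_dilogIntegral hz hz0))
  refine (h.congr_of_eventuallyEq (.of_forall fun w => ?_)).congr_fderiv ?_
  · simp [blochWigner, log_im]
  simp only [imMul_smul, imMul_add, imMul_sub]
  congr 1
  have hz1 := slitPlane_ne_zero hz
  rw [show log (1 - z) = (Real.log ‖1 - z‖ : ℂ) + (1 - z).arg * I from rfl, blochWignerDeriv]
  simp only [add_im, ofReal_im, im_ofReal_mul, I_im]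
  field_simp
  push_cast
  ring

/-- The factor `-1/z²` is the derivative of inversion, so this is the infinitesimal form of `D(1/z)
= -D(z)`. -/
theorem blochWignerDeriv_inv {z : ℂ} (hz0 : z ≠ 0) (hz1 : 1 - z ≠ 0) :
    blochWignerDeriv z⁻¹ * (-(z ^ 2)⁻¹) = -blochWignerDeriv z := by
  have l1 : Real.log ‖1 - z⁻¹‖ = Real.log ‖1 - z‖ - Real.log ‖z‖ := by
    rw [← Real.log_div (norm_ne_zero_iff.2 hz1) (norm_ne_zero_iff.2 hz0), ← norm_div, ← norm_neg]
    congr 2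
    field_simp
    ring
  have hz2 : z - 1 ≠ 0 := by rw [← neg_sub]; exact neg_ne_zero.2 hz1
  have hi : 1 - z⁻¹ = (z - 1) / z := by field_simp
  simp only [blochWignerDeriv, l1, norm_inv, Real.log_inv]
  rw [hi]
  simp
  field_simp
  ring

theorem HasFDerivAt.imMul_comp {D : ℂ → ℝ} {f : ℂ → ℂ} {c f' z : ℂ}
    (hD : HasFDerivAt D (imMul c) (f z)) (hf : HasDerivAt f f' z) :
    HasFDerivAt (fun w => D (f w)) (imMul (c * f')) z := by
  refine (hD.comp z (hf.hasFDerivAt.restrictScalars ℝ)).congr_fderiv ?_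
  ext v; simp [imMul_apply]; ring

/-- Proved first on the upper half-plane, where the derivative is already known on both sides, with
the constant fixed at `I`, whose inverse is its conjugate. Conjugation gives the lower half-plane.
The relation is then available to differentiate `D` across the cut. -/
theorem blochWigner_inv (z : ℂ) : blochWigner z⁻¹ = -blochWigner z := by
  have upper : ∀ z : ℂ, 0 < z.im → blochWigner z⁻¹ = -blochWigner z := by
    intro z hz
    have hd : ∀ w ∈ {w : ℂ | 0 < w.im},
        HasFDerivAt (fun w => blochWigner w + blochWigner w⁻¹) (0 : ℂ →L[ℝ] ℝ) w := by
      intro w hw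
      have hw' : 0 < w.im := hw
      have hw0 : w ≠ 0 := by rintro rfl; simp at hw'
      have hw1 : 1 - w ≠ 0 := slitPlane_ne_zero (mem_slitPlane_one_sub hw'.ne')
      have hi : w⁻¹.im ≠ 0 := by
        rw [inv_im]
        exact div_ne_zero (neg_ne_zero.2 hw'.ne') (normSq_pos.2 hw0).ne'
      have h1 := hasFDerivAt_blochWigner_of_slitPlane (mem_slitPlane_one_sub hw'.ne') hw0
      have h2 := hasFDerivAt_blochWigner_of_slitPlane (mem_slitPlane_one_sub hi) (inv_ne_zero hw0)
      refine (h1.add (h2.imMul_comp (hasDerivAt_inv hw0))).congr_fderiv ?_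
      rw [imMul_add, blochWignerDeriv_inv hw0 hw1, add_neg_cancel, imMul_zero]
    have hconv : Convex ℝ {w : ℂ | 0 < w.im} := convex_halfSpace_im_gt 0
    have hopen : IsOpen {w : ℂ | 0 < w.im} := isOpen_lt continuous_const continuous_im
    have hc := hopen.is_const_of_fderiv_eq_zero (𝕜 := ℝ) hconv.isPreconnected
      (fun w hw => (hd w hw).differentiableAt.differentiableWithinAt)
      (fun w hw => (hd w hw).fderiv) (show z ∈ _ from hz) (show I ∈ _ by simp)
    have hI : blochWigner I⁻¹ = - blochWigner I := by
      rw [← blochWigner_conj]; congr 1; simp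
    simp only [hI] at hc
    linarith
  rcases lt_trichotomy z.im 0 with h | h | h
  · have := upper (star z) (by simpa using h)
    rw [← star_inv₀, blochWigner_conj, blochWigner_conj] at this
    linarith
  · rw [blochWigner_of_im_eq_zero h, blochWigner_of_im_eq_zero (by simp [inv_im, h]), neg_zero]
  · exact upper z h

/-- On the cut `z > 1` the principal branches jump, but `D(z) = -D(1/z)` transports the question to
`1/z`, which lies off the cut. -/
theorem hasFDerivAt_blochWigner {z : ℂ} (hz0 : z ≠ 0) (hz1 : z ≠ 1) :
    HasFDerivAt blochWigner (imMul (blochWignerDeriv z)) z := by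
  have hz1' : 1 - z ≠ 0 := sub_ne_zero.2 hz1.symm
  by_cases h : 1 - z ∈ slitPlane
  · exact hasFDerivAt_blochWigner_of_slitPlane h hz0
  have him : z.im = 0 := by
    by_contra h'
    exact h (mem_slitPlane_one_sub h')
  have hre : 1 < z.re := by
    have h2 : ¬ 0 < (1 - z).re := fun h' => h (Or.inl h')
    simp only [sub_re, one_re, sub_pos, not_lt] at h2
    refine lt_of_le_of_ne h2 fun h3 => hz1 (Complex.ext h3.symm (by simpa using him))
  have hi : 1 - z⁻¹ ∈ slitPlane := by
    have : z = (z.re : ℂ) := Complex.ext (by simp) (by simp [him])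
    left
    rw [this, ← ofReal_inv]
    simp only [sub_re, one_re, ofReal_re, sub_pos]
    exact inv_lt_one_of_one_lt₀ hre
  have h1 := (hasFDerivAt_blochWigner_of_slitPlane hi (inv_ne_zero hz0)).imMul_comp
    (hasDerivAt_inv hz0)
  have h2 := h1.neg
  rw [blochWignerDeriv_inv hz0 hz1', imMul_neg, neg_neg] at h2
  refine h2.congr_of_eventuallyEq (.of_forall fun w => ?_)
  simp [blochWigner_inv]

/-- The complement of a finite set in the plane is connected, so no further boundary or branch
analysis is needed. -/
theorem eq_of_hasFDerivAt_zero {f : ℂ → ℝ} {s : Set ℂ} (hs : s.Finite)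
    (hf : ∀ z ∉ s, HasFDerivAt f (0 : ℂ →L[ℝ] ℝ) z) {z w : ℂ} (hz : z ∉ s) (hw : w ∉ s) :
    f z = f w := by
  have hc : IsPathConnected sᶜ := hs.countable.isPathConnected_compl_of_one_lt_rank
    (by rw [rank_real_complex]; norm_num)
  exact hs.isClosed.isOpen_compl.is_const_of_fderiv_eq_zero (𝕜 := ℝ)
    hc.isConnected.isPreconnected
    (fun w hw => (hf w hw).differentiableAt.differentiableWithinAt)
    (fun w hw => (hf w hw).fderiv) hz hw

/-! ### Functional equations -/

theorem blochWigner_one_sub (z : ℂ) : blochWigner (1 - z) = -blochWigner z := by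
  by_cases h : z.im = 0
  · rw [blochWigner_of_im_eq_zero h, blochWigner_of_im_eq_zero (by simp [h]), neg_zero]
  have hd : ∀ w ∉ ({0, 1} : Set ℂ),
      HasFDerivAt (fun w => blochWigner (1 - w) + blochWigner w) (0 : ℂ →L[ℝ] ℝ) w := by
    intro w hw
    simp only [mem_insert_iff, mem_singleton_iff, not_or] at hw
    have hw1 : 1 - w ≠ 0 := sub_ne_zero.2 (Ne.symm hw.2)
    have h1 := hasFDerivAt_blochWigner hw.1 hw.2
    have h2 := hasFDerivAt_blochWigner hw1 (by simpa using hw.1)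
    refine ((h2.imMul_comp ((hasDerivAt_id w).const_sub 1)).add h1).congr_fderiv ?_
    rw [imMul_add, ← imMul_zero]
    congr 1
    simp [blochWignerDeriv]
    ring
  have := eq_of_hasFDerivAt_zero (Set.toFinite _) hd (z := z) (w := 2)
    (by rintro (rfl | rfl) <;> simp at h) (by simp)
  simp only [blochWigner_of_im_eq_zero (show (2 : ℂ).im = 0 from rfl),
    blochWigner_of_im_eq_zero (show (1 - 2 : ℂ).im = 0 by simp)] at this
  linarith

theorem blochWigner_five_term {x y : ℂ} (hx0 : x ≠ 0) (hx1 : x ≠ 1) (hy0 : y ≠ 0)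
    (hy1 : y ≠ 1) (hxy : x ≠ y) :
    blochWigner x - blochWigner y + blochWigner (y / x) - blochWigner ((1 - y) / (1 - x)) +
      blochWigner (x * (1 - y) / (y * (1 - x))) = 0 := by
  set F : ℂ → ℂ → ℝ := fun x y => blochWigner x - blochWigner y + blochWigner (y / x) -
    blochWigner ((1 - y) / (1 - x)) + blochWigner (x * (1 - y) / (y * (1 - x))) with hF
  -- For fixed `y` the differential in `x` vanishes off `0, 1, y`. With the antisymmetry of `F` this
  -- lets either variable be moved to a real value, and `F` is zero when both are real.
  have hconst : ∀ x x' y : ℂ, y ≠ 0 → y ≠ 1 → x ∉ ({0, 1, y} : Set ℂ) →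
      x' ∉ ({0, 1, y} : Set ℂ) → F x y = F x' y := by
    intro x x' y hy0 hy1
    apply eq_of_hasFDerivAt_zero (f := fun x => F x y) (Set.toFinite _)
    intro x hx
    simp only [mem_insert_iff, mem_singleton_iff, not_or] at hx
    obtain ⟨hx0, hx1, hxy⟩ := hx
    have n1 : 1 - x ≠ 0 := sub_ne_zero.2 (Ne.symm hx1)
    have n2 : 1 - y ≠ 0 := sub_ne_zero.2 (Ne.symm hy1)
    have n3 : x - y ≠ 0 := sub_ne_zero.2 hxy
    have k1 : 1 - y / x = (x - y) / x := by field_simp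
    have k2 : 1 - (1 - y) / (1 - x) = -(x - y) / (1 - x) := by field_simp; ring
    have k3 : 1 - x * (1 - y) / (y * (1 - x)) = -(x - y) / (y * (1 - x)) := by field_simp; ring
    have ne1 : ∀ z : ℂ, 1 - z ≠ 0 → z ≠ 1 := fun z h => (sub_ne_zero.1 h).symm
    have d2 := (hasFDerivAt_blochWigner (z := y * x⁻¹) (mul_ne_zero hy0 (inv_ne_zero hx0))
      (ne1 _ (by rw [← div_eq_mul_inv, k1]; exact div_ne_zero n3 hx0))).imMul_comp
        (f := fun x => y * x⁻¹) ((hasDerivAt_inv hx0).const_mul y)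
    have e3 : HasDerivAt (fun x : ℂ => (1 - y) / (1 - x)) ((1 - y) / (1 - x) ^ 2) x := by
      have := (hasDerivAt_const x (1 - y)).fun_div ((hasDerivAt_id' x).const_sub 1) n1
      simpa using this
    have d3 := (hasFDerivAt_blochWigner (z := (1 - y) / (1 - x)) (div_ne_zero n2 n1)
      (ne1 _ (by rw [k2]; exact div_ne_zero (neg_ne_zero.2 n3) n1))).imMul_comp
        (f := fun x => (1 - y) / (1 - x)) e3
    have e4 : HasDerivAt (fun x : ℂ => x * (1 - y) / (y * (1 - x)))
        ((1 - y) / (y * (1 - x) ^ 2)) x := by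
      have := ((hasDerivAt_id' x).mul_const (1 - y)).fun_div
        (((hasDerivAt_id' x).const_sub 1).const_mul y) (mul_ne_zero hy0 n1)
      refine this.congr_deriv ?_
      field_simp
      ring
    have d4 := (hasFDerivAt_blochWigner (z := x * (1 - y) / (y * (1 - x)))
      (div_ne_zero (mul_ne_zero hx0 n2) (mul_ne_zero hy0 n1))
      (ne1 _ (by rw [k3]; exact div_ne_zero (neg_ne_zero.2 n3) (mul_ne_zero hy0 n1)))).imMul_comp
        (f := fun x => x * (1 - y) / (y * (1 - x))) e4
    have d := ((((hasFDerivAt_blochWigner hx0 hx1).sub_const (blochWigner y)).add d2).sub d3).add d4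
    refine (d.congr_of_eventuallyEq (.of_forall fun w => ?_)).congr_fderiv ?_
    · simp [hF, div_eq_mul_inv]
    simp only [imMul_add, imMul_sub]
    rw [← imMul_zero]
    congr 1
    simp only [blochWignerDeriv, ← div_eq_mul_inv]
    rw [k1, k2, k3]
    have m0 := norm_ne_zero_iff.2 hx0
    have m1 := norm_ne_zero_iff.2 n1
    have m2 := norm_ne_zero_iff.2 n2
    have m3 := norm_ne_zero_iff.2 n3
    have m4 := norm_ne_zero_iff.2 hy0
    simp only [norm_div, norm_mul, norm_neg]
    rw [Real.log_div m4 m0, Real.log_div m2 m1, Real.log_div m3 m0, Real.log_div m3 m1,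
      Real.log_div (mul_ne_zero m0 m2) (mul_ne_zero m4 m1), Real.log_mul m0 m2,
      Real.log_mul m4 m1, Real.log_div m3 (mul_ne_zero m4 m1), Real.log_mul m4 m1]
    push_cast
    field_simp
    ring
  have hanti : ∀ x y : ℂ, F x y = -F y x := by
    intro x y
    simp only [hF]
    rw [← inv_div x y, ← inv_div (1 - x) (1 - y), ← inv_div (y * (1 - x)) (x * (1 - y)),
      blochWigner_inv, blochWigner_inv, blochWigner_inv]
    ring
  have hreal : ∀ a b : ℝ, F a b = 0 := by
    intro a b
    have h1 := blochWigner_ofReal (b / a)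
    have h2 := blochWigner_ofReal ((1 - b) / (1 - a))
    have h3 := blochWigner_ofReal (a * (1 - b) / (b * (1 - a)))
    push_cast at h1 h2 h3
    simp only [hF, h1, h2, h3, blochWigner_ofReal]
    simp
  have hF2 : ∀ (x : ℂ) (b : ℝ), x ≠ 0 → x ≠ 1 → x ≠ b → b ≠ 0 → b ≠ 1 → F x b = 0 := by
    intro x b h0 h1 hb hb0 hb1
    obtain ⟨r, r0, r1, rb⟩ : ∃ r : ℝ, r ≠ 0 ∧ r ≠ 1 ∧ r ≠ b := by
      have := abs_nonneg b
      have := neg_abs_le b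
      -- This number is negative and smaller than `b`, so it avoids `0`, `1` and `b`.
      refine ⟨-1 - |b|, ?_, ?_, ?_⟩ <;> intro h <;> linarith
    rw [hconst x r b (by exact_mod_cast hb0) (by exact_mod_cast hb1)
      (by simp [h0, h1, hb]) ?_, hreal]
    simp only [mem_insert_iff, mem_singleton_iff, not_or]
    exact ⟨by exact_mod_cast r0, by exact_mod_cast r1, by exact_mod_cast rb⟩
  change F x y = 0
  by_cases hy : y.im = 0
  · have : y = (y.re : ℂ) := Complex.ext (by simp) (by simp [hy])
    rw [this] at hy0 hy1 hxy ⊢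
    exact hF2 x y.re hx0 hx1 hxy (by exact_mod_cast hy0) (by exact_mod_cast hy1)
  · have hy2 : y ≠ ((2 : ℝ) : ℂ) := by rintro rfl; simp at hy
    rw [hconst x ((2 : ℝ) : ℂ) y hy0 hy1 (by simp [hx0, hx1, hxy])
      (by simpa using fun h => hy2 (by simpa using h.symm)), hanti,
      hF2 y 2 hy0 hy1 hy2 (by norm_num) (by norm_num), neg_zero]

/-- The five-term relation for the points `∞, a, b, c, d` of the projective line. -/
theorem blochWigner_five_term_affine (a b c d : ℂ) :
    blochWigner ((d - b) / (c - b)) - blochWigner ((d - a) / (c - a)) +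
      blochWigner ((d - a) / (b - a)) - blochWigner ((c - a) / (b - a)) =
    blochWigner ((d - b) * (c - a) / ((c - b) * (d - a))) := by
  have hinv : ∀ u v : ℂ, blochWigner (u / v) = -blochWigner (v / u) := fun u v => by
    rw [← blochWigner_inv, inv_div]
  have self : ∀ u : ℂ, blochWigner (u / u) = 0 := fun u => by
    by_cases h : u = 0
    · simp [h, blochWigner_zero]
    · rw [div_self h, blochWigner_one]
  have hsub : ∀ u v w : ℂ, blochWigner ((u - v) / (w - v)) = -blochWigner ((u - w) / (v - w)) := by
    intro u v w
    by_cases h : w = v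
    · simp [h, blochWigner_zero]
    · rw [← blochWigner_one_sub]
      congr 1
      have := sub_ne_zero.2 h
      have := sub_ne_zero.2 (Ne.symm h)
      field_simp
      ring
  -- Coincident points are allowed: division by zero gives `0`, where `D` vanishes, and the
  -- surviving terms cancel in pairs.
  by_cases hab : a = b
  · subst hab
    rw [mul_comm (d - a), self]; simp [blochWigner_zero]
  by_cases hac : a = c
  · subst hac
    simp [blochWigner_zero, hsub d b a]
  by_cases had : a = d
  · subst had
    simp only [sub_self, zero_div, mul_zero, div_zero, blochWigner_zero]
    rw [hinv, hsub]; simp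
  by_cases hbc : b = c
  · subst hbc
    have : blochWigner ((b - a) / (b - a)) = 0 := self _
    simp [this, blochWigner_zero]
  by_cases hbd : b = d
  · subst hbd
    have : blochWigner ((b - a) / (b - a)) = 0 := self _
    simp [this, blochWigner_zero]
    rw [hinv]; simp
  by_cases hcd : c = d
  · subst hcd
    simp [self]
  have n : ∀ u v : ℂ, u ≠ v → v - u ≠ 0 := fun u v h => sub_ne_zero.2 (Ne.symm h)
  have nab := n _ _ hab
  have nac := n _ _ hac
  have nad := n _ _ had
  have nbc := n _ _ hbc
  have nbd := n _ _ hbd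
  have ncd := n _ _ hcd
  have ne1 : ∀ u v w : ℂ, v - u ≠ 0 → w - v ≠ 0 → (w - u) / (v - u) ≠ 1 := by
    intro u v w h h' h1
    rw [div_eq_one_iff_eq h] at h1
    exact h' (by linear_combination h1)
  have key := blochWigner_five_term (x := (c - a) / (b - a)) (y := (d - a) / (b - a))
    (div_ne_zero nac nab) (ne1 _ _ _ nab nbc) (div_ne_zero nad nab) (ne1 _ _ _ nab nbd)
    (by
      intro h
      rw [div_left_inj' nab] at h
      exact ncd (by linear_combination -h))
  have e1 : (d - a) / (b - a) / ((c - a) / (b - a)) = (d - a) / (c - a) := by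
    rw [div_div_div_cancel_right₀ nab]
  have f1 : ∀ u : ℂ, 1 - (u - a) / (b - a) = -(u - b) / (b - a) := fun u => by
    field_simp; ring
  have e2 : (1 - (d - a) / (b - a)) / (1 - (c - a) / (b - a)) = (d - b) / (c - b) := by
    rw [f1, f1, div_div_div_cancel_right₀ nab, neg_div_neg_eq]
  have e3 : (c - a) / (b - a) * (1 - (d - a) / (b - a)) /
      ((d - a) / (b - a) * (1 - (c - a) / (b - a))) =
      (d - b) * (c - a) / ((c - b) * (d - a)) := by
    rw [f1, f1]
    field_simp
  rw [e1, e2, e3] at key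
  linarith

end

theorem blochWigner_five_term_of_eq (a b c d : ℂ) {u₁ u₂ u₃ u₄ u₅ : ℂ}
    (h₁ : (d - b) / (c - b) = u₁) (h₂ : (d - a) / (c - a) = u₂) (h₃ : (d - a) / (b - a) = u₃)
    (h₄ : (c - a) / (b - a) = u₄) (h₅ : (d - b) * (c - a) / ((c - b) * (d - a)) = u₅) :
    blochWigner u₁ - blochWigner u₂ + blochWigner u₃ - blochWigner u₄ = blochWigner u₅ := by
  rw [← h₁, ← h₂, ← h₃, ← h₄, ← h₅, blochWigner_five_term_affine]

/-! ### Arguments in the same anharmonic orbit -/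

theorem blochWigner_of_eq_inv {a b : ℂ} (h : a = 1 / b) : blochWigner a = -blochWigner b := by
  rw [h, one_div, blochWigner_inv]

theorem blochWigner_of_eq_one_sub {a b : ℂ} (h : a = 1 - b) :
    blochWigner a = -blochWigner b := by
  rw [h, blochWigner_one_sub]

theorem blochWigner_of_eq_inv_one_sub {a b : ℂ} (h : a = 1 / (1 - b)) :
    blochWigner a = blochWigner b := by
  rw [h, one_div, blochWigner_inv, blochWigner_one_sub, neg_neg]

theorem blochWigner_of_eq_one_sub_inv {a b : ℂ} (h : a = 1 - 1 / b) :
    blochWigner a = blochWigner b := by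
  rw [h, one_div, blochWigner_one_sub, blochWigner_inv, neg_neg]

theorem blochWigner_of_eq_div_sub_one {a b : ℂ} (h : a = b / (b - 1)) :
    blochWigner a = -blochWigner b := by
  rcases eq_or_ne b 0 with rfl | hb
  · simp [h, blochWigner_zero]
  · rw [← blochWigner_inv]
    apply blochWigner_of_eq_inv_one_sub
    rw [h]
    field_simp

theorem blochWigner_of_eq_star {a b : ℂ} (h : a = star b) : blochWigner a = -blochWigner b := by
  rw [h, blochWigner_conj]

/-! ### Configurations on the boundary of a complex line -/

/-- Five-term relation for `∞, 0, 1, x, 1/y`: the term with argument `1/(xy)` is real and drops out.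
-/
theorem blochWigner_sum_of_mul_real {x y : ℂ} (hy0 : y ≠ 0) (hx1 : 1 - x ≠ 0)
    (hy1 : 1 - y ≠ 0) (hxy : (x * y).im = 0) :
    blochWigner x + blochWigner y + blochWigner (-x * (1 - y) / (1 - x)) +
      blochWigner (-y * (1 - x) / (1 - y)) = 0 := by
  have h := blochWigner_five_term_affine 0 1 x (1 / y)
  have hx1' : x - 1 ≠ 0 := by rw [← neg_sub]; exact neg_ne_zero.2 hx1
  have e1 : blochWigner ((1 / y - 1) / (x - 1)) = -blochWigner (-y * (1 - x) / (1 - y)) := by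
    apply blochWigner_of_eq_inv
    field_simp
    ring
  have e2 : blochWigner ((1 / y - 0) / (x - 0)) = 0 := by
    rw [blochWigner_of_eq_inv (b := x * y) (by simp; ring), blochWigner_of_im_eq_zero hxy, neg_zero]
  have e3 : blochWigner ((1 / y - 0) / (1 - 0)) = -blochWigner y :=
    blochWigner_of_eq_inv (by simp)
  have e4 : (x - 0) / (1 - 0) = x := by simp
  have e5 : (1 / y - 1) * (x - 0) / ((x - 1) * (1 / y - 0)) = -x * (1 - y) / (1 - x) := by
    rw [sub_zero, sub_zero]
    field_simp
    ring
  rw [e1, e2, e3, e4, e5] at h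
  linarith

/-! ### The five-term relations of a pair of edge invariants

In this section `X`, `Y`, `E`, `F`, `H` stand for the conjugates of `x`, `y`, `e`, `f`, `h`. -/

section

variable {x y X Y e E f F h H δ : ℂ}

/-- Points `∞, 0, x, q, Yq` with `q = x e / δ`. The auxiliary points are such that the differences
factor, as `k1` and `k2` show. -/
theorem five_term_pencil_a (hx : x ≠ 0) (hY : Y ≠ 0) (he : e ≠ 0) (hδ : δ ≠ 0) (dE : E = x - Y)
    (de : e = X - y) (dh : h = e - δ) (dδ : δ = X * Y - x * y) :
    blochWigner (y * E / h) - blochWigner Y + blochWigner (Y * e / δ) - blochWigner (e / δ) =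
      blochWigner (y * E / (h * Y)) := by
  have k1 : Y * (x * e / δ) - x = x * (y * E) / δ := by
    field_simp; subst dE de dδ; ring
  have k2 : x * e / δ - x = x * h / δ := by
    field_simp; subst dh; ring
  refine blochWigner_five_term_of_eq 0 x (x * e / δ) (Y * (x * e / δ)) ?_ ?_ ?_ ?_ ?_
  · rw [k1, k2]; field_simp
  · simp only [sub_zero]; field_simp
  · simp only [sub_zero]; field_simp
  · simp only [sub_zero]; field_simp
  · rw [k1, k2]; simp only [sub_zero]; field_simp

/-- Points `∞, 1, x, q, r` with `q = x e / δ` and `r = q (1 - XY) / (1 - X)`. -/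
theorem five_term_pencil_b (hx : x ≠ 0) (hX : X ≠ 0) (hX1 : 1 - X ≠ 0) (hx1 : 1 - x ≠ 0)
    (hE : E ≠ 0) (hδ : δ ≠ 0)
    (dE : E = x - Y) (de : e = X - y) (dh : h = e - δ) (dδ : δ = X * Y - x * y)
    (df : f = X * (1 - Y) * (1 - y) - y * (1 - x) * (1 - X))
    (dF : F = x * (1 - Y) * (1 - y) - Y * (1 - x) * (1 - X)) :
    blochWigner (f / ((1 - X) * h)) - blochWigner (F / ((1 - X) * E)) +
      blochWigner (-(X * F) / ((1 - x) * (1 - X) * δ)) - blochWigner (-(X * E) / ((1 - x) * δ)) =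
      blochWigner (f * E / (h * F)) := by
  have hx1' : x - 1 ≠ 0 := by rw [← neg_sub]; exact neg_ne_zero.2 hx1
  have k1 : x * e * (1 - X * Y) / ((1 - X) * δ) - x = x * f / ((1 - X) * δ) := by
    field_simp; subst df dδ de; ring
  have k2 : x * e / δ - x = x * h / δ := by
    field_simp; subst dh; ring
  have k3 : x * e * (1 - X * Y) / ((1 - X) * δ) - 1 = X * F / ((1 - X) * δ) := by
    field_simp; subst dF dδ de; ring
  have k4 : x * e / δ - 1 = X * E / δ := by
    field_simp; subst dE dδ de; ring
  refine blochWigner_five_term_of_eq 1 x (x * e / δ) (x * e * (1 - X * Y) / ((1 - X) * δ))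
    ?_ ?_ ?_ ?_ ?_
  · rw [k1, k2]; field_simp
  · rw [k3, k4]; field_simp
  · rw [k3]; field_simp; ring
  · rw [k4]; field_simp; ring
  · rw [k1, k2, k3, k4]; field_simp

/-- Points `∞, 0, 1, x, q`, with the same `q`. -/
theorem five_term_pencil_c (hx : x ≠ 0) (hx1 : 1 - x ≠ 0) (he : e ≠ 0) (hδ : δ ≠ 0)
    (dE : E = x - Y) (de : e = X - y) (dδ : δ = X * Y - x * y) :
    blochWigner (-(X * E) / ((1 - x) * δ)) - blochWigner (e / δ) +
      blochWigner (x * e / δ) - blochWigner x =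
      blochWigner (-(X * E) / ((1 - x) * e)) := by
  have hx1' : x - 1 ≠ 0 := by rw [← neg_sub]; exact neg_ne_zero.2 hx1
  have k4 : x * e / δ - 1 = X * E / δ := by
    field_simp; subst dE dδ de; ring
  refine blochWigner_five_term_of_eq 0 1 x (x * e / δ) ?_ ?_ ?_ ?_ ?_
  · rw [k4]; field_simp; ring
  · simp only [sub_zero]; field_simp
  · simp only [sub_zero, div_one]
  · simp only [sub_zero, div_one]
  · rw [k4]; simp only [sub_zero]; field_simp; ring

/-- Points `∞, x, q, Yq, r`, with the same `q` and `r`. -/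
theorem five_term_pencil_d (hx : x ≠ 0) (he : e ≠ 0) (hy : y ≠ 0) (hE : E ≠ 0) (hf : f ≠ 0)
    (hX1 : 1 - X ≠ 0) (hY1 : 1 - Y ≠ 0) (hδ : δ ≠ 0)
    (dE : E = x - Y) (de : e = X - y) (dh : h = e - δ) (dδ : δ = X * Y - x * y)
    (df : f = X * (1 - Y) * (1 - y) - y * (1 - x) * (1 - X)) :
    blochWigner (X / (X - 1)) - blochWigner (f / ((1 - X) * (y * E))) +
      blochWigner (f / ((1 - X) * h)) - blochWigner (y * E / h) =
      blochWigner (-(X * y * E) / f) := by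
  have hX1' : X - 1 ≠ 0 := by rw [← neg_sub]; exact neg_ne_zero.2 hX1
  have k1 : x * e * (1 - X * Y) / ((1 - X) * δ) - x = x * f / ((1 - X) * δ) := by
    field_simp; subst df dδ de; ring
  have k2 : x * e / δ - x = x * h / δ := by
    field_simp; subst dh; ring
  have k3 : Y * (x * e / δ) - x = x * (y * E) / δ := by
    field_simp; subst dE de dδ; ring
  have k4 : x * e * (1 - X * Y) / ((1 - X) * δ) - x * e / δ =
      x * e * X * (1 - Y) / ((1 - X) * δ) := by
    field_simp; ring
  have k5 : Y * (x * e / δ) - x * e / δ = -(x * e * (1 - Y) / δ) := by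
    field_simp; ring
  refine blochWigner_five_term_of_eq x (x * e / δ) (Y * (x * e / δ))
    (x * e * (1 - X * Y) / ((1 - X) * δ))
    ?_ ?_ ?_ ?_ ?_
  · rw [k4, k5]; field_simp; ring
  · rw [k1, k3]; field_simp
  · rw [k1, k2]; field_simp
  · rw [k2, k3]; field_simp
  · rw [k1, k3, k4, k5]; field_simp

/-- The identity of the third part after `s` and `t` have been eliminated. The number `δ` is the
conjugate of `xy` minus `xy`, and it appears in the denominators of the auxiliary points; hence the
separate case `δ = 0`. -/
theorem sum_blochWigner_of_ne (hx : x ≠ 0) (hX : X ≠ 0) (hy : y ≠ 0) (hY : Y ≠ 0)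
    (hx1 : 1 - x ≠ 0) (hX1 : 1 - X ≠ 0) (hy1 : 1 - y ≠ 0) (hY1 : 1 - Y ≠ 0)
    (he : e ≠ 0) (hE : E ≠ 0) (hf : f ≠ 0) (hF : F ≠ 0)
    (sx : star x = X) (sy : star y = Y)
    (dE : E = x - Y) (de : e = X - y)
    (df : f = X * (1 - Y) * (1 - y) - y * (1 - x) * (1 - X))
    (dF : F = x * (1 - Y) * (1 - y) - Y * (1 - x) * (1 - X)) {s t : ℂ}
    (hs : s = -X * (1 - y) * E / ((1 - x) * e)) (ht : t = -Y * (1 - x) * e / ((1 - y) * E)) :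
    blochWigner (y * F / (Y * f)) + blochWigner (x * f / (X * F)) +
      blochWigner (Y * e / (y * E)) + blochWigner (X * E / (x * e)) =
    2 * (blochWigner x + blochWigner y + blochWigner s + blochWigner t) := by
  have sX : star X = x := by rw [← sx, star_star]
  have sY : star Y = y := by rw [← sy, star_star]
  have se : star e = E := by rw [de, dE, star_sub, sX, sy]
  have sE : star E = e := by rw [← se, star_star]
  have sf : star f = F := by
    rw [df, dF]
    simp only [star_sub, star_mul', star_one, sx, sX, sy, sY]
    ring
  have sF : star F = f := by rw [← sf, star_star]
  obtain ⟨δ, dδ⟩ : ∃ δ, δ = X * Y - x * y := ⟨_, rfl⟩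
  have sδ : star δ = -δ := by
    rw [dδ]
    simp only [star_sub, star_mul', sx, sX, sy, sY]
    ring
  by_cases hδ : δ = 0
  · have hxy : X * Y = x * y := by rw [hδ] at dδ; linear_combination -dδ
    -- For `xy` real each of the four arguments on the left equals `1`.
    have one : ∀ u v : ℂ, v ≠ 0 → u = v → blochWigner (u / v) = 0 := by
      rintro u v hv rfl
      rw [div_self hv, blochWigner_one]
    rw [one _ _ (mul_ne_zero hY hf) (by rw [df, dF]; linear_combination -(1 - y) * (1 - Y) * hxy),
      one _ _ (mul_ne_zero hX hF) (by rw [df, dF]; linear_combination (1 - x) * (1 - X) * hxy),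
      one _ _ (mul_ne_zero hy hE) (by rw [de, dE]; linear_combination hxy),
      one _ _ (mul_ne_zero hx he) (by rw [de, dE]; linear_combination -hxy)]
    have him : (x * y).im = 0 := by
      rw [← Complex.conj_eq_iff_im, map_mul]
      change star x * star y = _
      rw [sx, sy, hxy]
    have h1 := blochWigner_sum_of_mul_real hy hx1 hy1 him
    have es : s = -x * (1 - y) / (1 - x) := by
      rw [hs, div_eq_div_iff (mul_ne_zero hx1 he) hx1, de, dE]
      linear_combination (1 - y) * (1 - x) * hxy
    have et : t = -y * (1 - x) / (1 - y) := by
      rw [ht, div_eq_div_iff (mul_ne_zero hy1 hE) hy1, de, dE]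
      linear_combination -(1 - y) * (1 - x) * hxy
    rw [es, et]
    linarith
  obtain ⟨h, dh⟩ : ∃ h, h = e - δ := ⟨_, rfl⟩
  obtain ⟨H, dH⟩ : ∃ H, H = E + δ := ⟨_, rfl⟩
  have sh : star h = H := by rw [dh, dH, star_sub, se, sδ]; ring
  have A := five_term_pencil_a hx hY he hδ dE de dh dδ
  have B := five_term_pencil_b hx hX hX1 hx1 hE hδ dE de dh dδ df dF
  have C := five_term_pencil_c hx hx1 he hδ dE de dδ
  have D := five_term_pencil_d hx he hy hE hf hX1 hY1 hδ dE de dh dδ df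
  -- Exchanging `x` and `y` fixes `δ` and sends `e, h, f` to `-E, -H, -F`.
  have B' := five_term_pencil_b (x := y) (y := x) (X := Y) (Y := X) (e := -E) (E := -e)
    (h := -H) (f := -F) (F := -f) hy hY hY1 hy1 (neg_ne_zero.2 he) hδ
    (by rw [de]; ring) (by rw [dE]; ring) (by rw [dH]; ring) (by rw [dδ]; ring)
    (by rw [dF]; ring) (by rw [df]; ring)
  have D' := five_term_pencil_d (x := y) (y := x) (X := Y) (Y := X) (e := -E) (E := -e)
    (h := -H) (f := -F) hy (neg_ne_zero.2 hE) hx (neg_ne_zero.2 he) (neg_ne_zero.2 hF) hY1 hX1 hδ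
    (by rw [de]; ring) (by rw [dE]; ring) (by rw [dH]; ring) (by rw [dδ]; ring)
    (by rw [dF]; ring)
  simp only [mul_neg, neg_mul, neg_neg, neg_div, div_neg] at B' D'
  have i1 : blochWigner Y = -blochWigner y := blochWigner_of_eq_star sy.symm
  have i1' : blochWigner X = -blochWigner x := blochWigner_of_eq_star sx.symm
  obtain ⟨S, hS⟩ : ∃ S, S = -x * (1 - Y) * e / ((1 - X) * E) := ⟨_, rfl⟩
  obtain ⟨T, hT⟩ : ∃ T, T = -y * (1 - X) * E / ((1 - Y) * e) := ⟨_, rfl⟩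
  have DS : blochWigner S = -blochWigner s := blochWigner_of_eq_star (by
    rw [hS, hs]; simp only [star_div₀, star_mul', star_neg, star_sub, star_one, sx, sX, sy, se, sE])
  have DT : blochWigner T = -blochWigner t := blochWigner_of_eq_star (by
    rw [hT, ht]; simp only [star_div₀, star_mul', star_neg, star_sub, star_one, sx, sY, sy, se, sE])
  have i2 : blochWigner (Y * e / δ) = -blochWigner (Y * e / (y * E)) := by
    apply blochWigner_of_eq_div_sub_one
    have : Y * e / (y * E) - 1 = δ / (y * E) := by field_simp; rw [dδ, de, dE]; ring
    rw [this]; field_simp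
  have i3 : blochWigner (-(X * F) / ((1 - x) * (1 - X) * δ)) =
      blochWigner (x * f / (X * F)) := by
    apply blochWigner_of_eq_inv_one_sub
    have : 1 - x * f / (X * F) = -((1 - x) * (1 - X) * δ) / (X * F) := by
      field_simp; rw [dδ, df, dF]; ring
    rw [this]; field_simp
  have i3' : blochWigner (Y * f / ((1 - y) * (1 - Y) * δ)) =
      blochWigner (y * F / (Y * f)) := by
    apply blochWigner_of_eq_inv_one_sub
    have : 1 - y * F / (Y * f) = (1 - y) * (1 - Y) * δ / (Y * f) := by
      field_simp; rw [dδ, df, dF]; ring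
    rw [this]; field_simp
  have i4 : blochWigner (F / ((1 - X) * E)) = blochWigner s := by
    rw [← neg_neg (blochWigner s), ← DS]
    apply blochWigner_of_eq_one_sub
    rw [hS]; field_simp; rw [dF, de, dE]; ring
  have i5 : blochWigner (x * e / δ) = blochWigner (X * E / (x * e)) := by
    apply blochWigner_of_eq_inv_one_sub
    have : 1 - X * E / (x * e) = δ / (x * e) := by field_simp; rw [dδ, de, dE]; ring
    rw [this]; field_simp
  have i6 : blochWigner (f / ((1 - X) * (y * E))) = -blochWigner t := by
    rw [← DT]
    apply blochWigner_of_eq_one_sub_inv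
    rw [hT]; field_simp; rw [df, de, dE]; ring
  have i6' : blochWigner (F / ((1 - Y) * (x * e))) = -blochWigner s := by
    rw [← DS]
    apply blochWigner_of_eq_one_sub_inv
    rw [hS]; field_simp; rw [dF, de, dE]; ring
  have i7 : blochWigner (f / ((1 - Y) * e)) = blochWigner t := by
    rw [← neg_neg (blochWigner t), ← DT]
    apply blochWigner_of_eq_one_sub
    rw [hT]; field_simp; rw [df, de, dE]; ring
  have j1 : blochWigner (Y * e / ((1 - y) * δ)) = blochWigner (y * E / (h * Y)) := by
    have v : blochWigner (-(y * E) / ((1 - Y) * δ)) = blochWigner (Y * h / (y * E)) := by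
      apply blochWigner_of_eq_inv_one_sub
      have : 1 - Y * h / (y * E) = -((1 - Y) * δ) / (y * E) := by
        field_simp; rw [dh, dδ, de, dE]; ring
      rw [this]; field_simp
    rw [blochWigner_of_eq_inv (a := y * E / (h * Y)) (b := Y * h / (y * E))
      (by rw [one_div_div, mul_comm h]), ← v]
    apply blochWigner_of_eq_star
    simp only [star_div₀, star_mul', star_neg, star_sub, star_one, sY, sy, sE, sδ, mul_neg,
      neg_div_neg_eq]
  have j2 : blochWigner (F * e / (H * f)) = -blochWigner (f * E / (h * F)) := by
    rw [← blochWigner_of_eq_star (a := F * e / (H * f)) (b := f * E / (h * F))]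
    simp only [star_div₀, star_mul', sE, sf, sF, sh]
  have j3 : blochWigner (x * e / H) = blochWigner (-(X * E) / ((1 - x) * e)) := by
    have v : blochWigner (H / (x * e)) = blochWigner (-(x * e) / ((1 - X) * E)) := by
      apply blochWigner_of_eq_one_sub_inv
      field_simp
      rw [dH, dδ, de, dE]; ring
    rw [blochWigner_of_eq_inv (a := x * e / H) (b := H / (x * e)) (one_div_div _ _).symm, v,
      blochWigner_of_eq_star (a := -(x * e) / ((1 - X) * E)) (b := -(X * E) / ((1 - x) * e)),
      neg_neg]
    simp only [star_div₀, star_mul', star_neg, star_sub, star_one, sX, sx, sE, se]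
  have j4 : blochWigner (-(Y * x * e / F)) = -blochWigner (-(X * y * E) / f) := by
    apply blochWigner_of_eq_star
    simp only [star_div₀, star_mul', star_neg, sX, sy, sE, sf]
    ring
  have i8 : blochWigner (X / (X - 1)) = blochWigner x := by
    rw [blochWigner_of_eq_div_sub_one rfl, i1', neg_neg]
  have i8' : blochWigner (Y / (Y - 1)) = blochWigner y := by
    rw [blochWigner_of_eq_div_sub_one rfl, i1, neg_neg]
  -- Let `Σ = D(x) + D(y) + D(s) + D(t)` and `Q = D(f/((1-X)h)) + D(F/((1-Y)H)) - D(yE/h) -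
  -- D(xe/H)`. Then `B + B' + C - A` says that the left side is `Σ - Q`, while `D + D'` says `Q =
  -- -Σ`.
  rw [i1, i2] at A
  rw [i3, i4] at B
  rw [i5] at C
  rw [i8, i6] at D
  rw [i7, i3', j1, j2] at B'
  rw [i8', i6', j3, j4] at D'
  linarith

end

/-! ### Cross-ratio structures satisfying the CR constraints -/

theorem IsCRCrossRatio.sum_blochWigner {z : Fin 4 → Fin 4 → ℂ} (h : IsCRCrossRatio z) :
    blochWigner (z 1 0 * z 3 0 * z 2 0) + blochWigner (z 0 1 * z 2 1 * z 3 1) +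
        blochWigner (z 0 2 * z 1 2 * z 3 2) + blochWigner (z 0 3 * z 1 3 * z 2 3) =
      2 * (blochWigner (z 0 1) + blochWigner (z 1 0) +
        blochWigner (z 2 3) + blochWigner (z 3 2)) := by
  have sim : ∀ i j k l : Fin 4, ∀ σ : Equiv.Perm (Fin 4), Equiv.Perm.sign σ = 1 →
      σ 0 = i → σ 1 = j → σ 2 = k → σ 3 = l → z i k = 1 / (1 - z i j) := by
    rintro _ _ _ _ σ hσ rfl rfl rfl rfl
    exact h.similarity σ hσ
  have cr : ∀ i j k l : Fin 4, ∀ σ : Equiv.Perm (Fin 4), Equiv.Perm.sign σ = 1 →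
      σ 0 = i → σ 1 = j → σ 2 = k → σ 3 = l → z i j * z j i = star (z k l * z l k) := by
    rintro _ _ _ _ σ hσ rfl rfl rfl rfl
    exact h.cr σ hσ
  have s02 := sim 0 1 2 3 1 (by decide) rfl rfl rfl rfl
  have s03 := sim 0 2 3 1 c[1, 2, 3] (by decide) rfl rfl rfl rfl
  have s13 := sim 1 0 3 2 (c[0, 1] * c[2, 3]) (by decide) (by decide) (by decide) (by decide)
    (by decide)
  have s12 := sim 1 3 2 0 c[0, 1, 3] (by decide) (by decide) (by decide) (by decide)
    (by decide)
  have s20 := sim 2 3 0 1 (c[0, 2] * c[1, 3]) (by decide) (by decide) (by decide) (by decide)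
    (by decide)
  have s21 := sim 2 0 1 3 c[0, 2, 1] (by decide) (by decide) (by decide) (by decide)
    (by decide)
  have s31 := sim 3 2 1 0 (c[0, 3] * c[1, 2]) (by decide) (by decide) (by decide) (by decide)
    (by decide)
  have s30 := sim 3 1 0 2 c[0, 3, 2] (by decide) (by decide) (by decide) (by decide)
    (by decide)
  have c2 := cr 0 2 3 1 c[1, 2, 3] (by decide) rfl rfl rfl rfl
  have c3 := cr 0 3 1 2 c[1, 3, 2] (by decide) (by decide) (by decide) (by decide)
    (by decide)
  have x0 := h.ne_zero 0 1 (by decide)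
  have x1 := h.ne_one 0 1 (by decide)
  have y0 := h.ne_zero 1 0 (by decide)
  have y1 := h.ne_one 1 0 (by decide)
  have s0 := h.ne_zero 2 3 (by decide)
  have s1 := h.ne_one 2 3 (by decide)
  have t0 := h.ne_zero 3 2 (by decide)
  have t1 := h.ne_one 3 2 (by decide)
  rw [s02] at s03
  rw [s13] at s12
  rw [s20] at s21
  rw [s31] at s30
  rw [s30, s20, s21, s31, s02, s12, s03, s13]
  rw [s02, s20, s31, s13] at c2
  rw [s03, s30, s12, s21] at c3
  clear s02 s03 s13 s12 s20 s21 s31 s30 sim cr h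
  generalize z 0 1 = x at *
  generalize z 1 0 = y at *
  generalize z 2 3 = s at *
  generalize z 3 2 = t at *
  clear z
  have q : ∀ w : ℂ, w ≠ 0 → w ≠ 1 → 1 / (1 - 1 / (1 - w)) = 1 - 1 / w := by
    intro w h0 h1
    have : 1 - w ≠ 0 := sub_ne_zero.2 h1.symm
    have e : 1 - 1 / (1 - w) = -w / (1 - w) := by field_simp; ring
    rw [e]; field_simp; ring
  rw [q x x0 x1, q y y0 y1, q s s0 s1, q t t0 t1] at *
  have sub : ∀ w : ℂ, w ≠ 1 → 1 - w ≠ 0 := fun w h => sub_ne_zero.2 h.symm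
  have hs1 := sub s s1
  have ht1 := sub t t1
  have star0 : ∀ w : ℂ, w ≠ 0 → star w ≠ 0 := fun w h => star_ne_zero.2 h
  have star1 : ∀ w : ℂ, w ≠ 1 → 1 - star w ≠ 0 := fun w h h' => sub w h (by
    rw [← star_eq_zero]; simpa using h')
  obtain ⟨X, hX⟩ : ∃ X, star x = X := ⟨_, rfl⟩
  obtain ⟨Y, hY⟩ : ∃ Y, star y = Y := ⟨_, rfl⟩
  obtain ⟨T, hT⟩ : ∃ T, star t = T := ⟨_, rfl⟩
  have X0 := hX ▸ star0 x x0
  have Y0 := hY ▸ star0 y y0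
  have T0 := hT ▸ star0 t t0
  have X1 := hX ▸ star1 x x1
  have Y1 := hY ▸ star1 y y1
  have T1 := hT ▸ star1 t t1
  have hx1 := sub x x1
  have hy1 := sub y y1
  have sX : star X = x := by rw [← hX, star_star]
  have sY : star Y = y := by rw [← hY, star_star]
  have sT : star T = t := by rw [← hT, star_star]
  have d2 : (1 - x) * (1 - s) = (1 - Y) * (1 - T) := by
    simp only [star_div₀, star_mul', star_sub, star_one, hY, hT] at c2
    field_simp at c2
    linear_combination -c2
  have d3 : (1 - X) * (1 - T) * y * s = (1 - y) * (1 - s) * X * T := by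
    have c3' := congrArg star c3
    simp only [star_div₀, star_mul', star_sub, star_one, star_star, hX, hT] at c3'
    field_simp at c3'
    linear_combination c3'
  -- When `y` is the conjugate of `x`, the CR equation forces `t` to be the conjugate of `s`, and
  -- both sides of the identity vanish by oddness of `D` under conjugation.
  by_cases he : X - y = 0
  · obtain rfl : X = y := sub_eq_zero.1 he
    obtain rfl : x = Y := by rw [← sX, hY]
    obtain rfl : T = s := by
      have := mul_left_cancel₀ hx1 d2
      linear_combination this
    rw [blochWigner_of_eq_star (a := X * (1 - 1 / t) * (1 / (1 - T)))
      (b := x * (1 - 1 / T) * (1 / (1 - t))), blochWigner_of_eq_star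
      (a := 1 / (1 - x) * (1 - 1 / X) * t) (b := (1 - 1 / x) * (1 / (1 - X)) * T),
      blochWigner_of_eq_star hX.symm, blochWigner_of_eq_star hT.symm]
    · ring
    · simp only [star_div₀, star_mul', star_sub, star_one, sX, hX, sT]; ring
    · simp only [star_div₀, star_mul', star_sub, star_one, hX, sT, hT]
  obtain ⟨e, de⟩ : ∃ e, e = X - y := ⟨_, rfl⟩
  obtain ⟨E, dE⟩ : ∃ E, E = x - Y := ⟨_, rfl⟩
  rw [← de] at he
  have hE : E ≠ 0 := by
    rw [dE, ← sX, ← hY, ← star_sub, ← de]; exact star0 e he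
  -- `key1` and `key2` are linear in `s` and `T`; eliminating `T` leaves `s` with coefficient `(1 -
  -- x) e` up to sign, so `e ≠ 0` is what makes the system solvable.
  have key1 : (1 - x) * (1 - X) * y * s = (1 - y) * (1 - Y) * X * T := by
    apply mul_left_cancel₀ hs1
    linear_combination (1 - Y) * d3 + (1 - X) * y * s * d2
  have key2 : (1 - Y) * T = E + (1 - x) * s := by
    rw [dE]; linear_combination d2
  have hs : s = -X * (1 - y) * E / ((1 - x) * e) := by
    rw [eq_div_iff (mul_ne_zero hx1 he), de]
    linear_combination -key1 - (1 - y) * X * key2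
  have hTe : e * (1 - Y) * T = -y * E * (1 - X) := by
    have : s * ((1 - x) * e) = -X * (1 - y) * E := by
      rw [hs, div_mul_cancel₀ _ (mul_ne_zero hx1 he)]
    rw [de] at this ⊢
    linear_combination (X - y) * key2 + this
  have ht : t = -Y * (1 - x) * e / ((1 - y) * E) := by
    have := congrArg star hTe
    have se : star e = E := by rw [de, dE, star_sub, sX, hY]
    have sE : star E = e := by rw [← se, star_star]
    simp only [star_mul', star_neg, star_sub, star_one, se, sE, sY, hY, sT, sX] at this
    rw [eq_div_iff (mul_ne_zero hy1 hE)]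
    linear_combination this
  obtain ⟨f, df⟩ : ∃ f, f = X * (1 - Y) * (1 - y) - y * (1 - x) * (1 - X) := ⟨_, rfl⟩
  obtain ⟨F, dF⟩ : ∃ F, F = x * (1 - Y) * (1 - y) - Y * (1 - x) * (1 - X) := ⟨_, rfl⟩
  have es : 1 - s = f / ((1 - x) * e) := by
    rw [hs]; field_simp; rw [df, de, dE]; ring
  have et : 1 - t = F / ((1 - y) * E) := by
    rw [ht]; field_simp; rw [dF, de, dE]; ring
  -- The non-degeneracy of `f` and `F` is `s ≠ 1` and `t ≠ 1`.
  have hf : f ≠ 0 := by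
    rintro rfl; rw [zero_div] at es; exact hs1 es
  have hF : F ≠ 0 := by
    rintro rfl; rw [zero_div] at et; exact ht1 et
  rw [← sum_blochWigner_of_ne x0 X0 y0 Y0 hx1 X1 hy1 Y1 he hE hf hF hX hY dE de df dF hs ht]
  have w : ∀ w : ℂ, w ≠ 0 → 1 - 1 / w = -(1 - w) / w := by
    intro w hw; field_simp; ring
  rw [w t t0, w s s0, w x x0, w y y0, es, et, hs, ht]
  congr 1
  · congr 1
    · congr 1
      · congr 1; field_simp
      · congr 1; field_simp
    · congr 1; field_simp
  · congr 1; field_simp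

/-! ### Null vectors -/

theorem star_herm (u v : Fin 3 → ℂ) : star (herm u v) = herm v u := by
  simp [herm, J, Matrix.mulVec, dotProduct, Fin.sum_univ_three]
  ring

theorem herm_add_left (a b c : Fin 3 → ℂ) : herm (a + b) c = herm a c + herm b c := by
  simp [herm, Matrix.mulVec_add, dotProduct_add]

theorem herm_add_right (a b c : Fin 3 → ℂ) : herm c (a + b) = herm c a + herm c b := by
  rw [← star_herm, herm_add_left, star_add, star_herm, star_herm]

theorem herm_smul_left (k : ℂ) (a b : Fin 3 → ℂ) : herm (k • a) b = k * herm a b := by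
  simpa using herm_smul_smul k 1 a b

theorem herm_smul_right (k : ℂ) (a b : Fin 3 → ℂ) : herm a (k • b) = star k * herm a b := by
  simpa using herm_smul_smul 1 k a b

/-- In signature `(2,1)` there is no isotropic plane. Concretely, a null vector with vanishing last
coordinate is a multiple of the first basis vector, and subtracting a multiple of `v` from `u`
reaches that situation. -/
theorem exists_smul_eq_of_herm_eq_zero {u v : Fin 3 → ℂ} (hu : herm u u = 0) (hv : herm v v = 0)
    (huv : herm u v = 0) (hv0 : v ≠ 0) : ∃ k : ℂ, u = k • v := by
  have hc : ∀ a b : Fin 3 → ℂ, herm a b =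
      star (b 0) * a 2 + star (b 1) * a 1 + star (b 2) * a 0 := by
    intro a b
    simp [herm, J, Matrix.mulVec, dotProduct, Fin.sum_univ_three]
  have null : ∀ w : Fin 3 → ℂ, herm w w = 0 → w 2 = 0 → w 1 = 0 := by
    intro w hw h2
    rw [hc, h2] at hw
    simpa using hw
  by_cases h2 : v 2 = 0
  · have h1 := null v hv h2
    have h0 : v 0 ≠ 0 := fun h0 => hv0 (by ext i; fin_cases i <;> simp [*])
    have u2 : u 2 = 0 := by
      rw [hc, h1, h2] at huv
      simpa [h0] using huv
    have u1 := null u hu u2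
    refine ⟨u 0 / v 0, ?_⟩
    ext i; fin_cases i <;> simp [*]
  · refine ⟨u 2 / v 2, ?_⟩
    obtain ⟨w, hw⟩ : ∃ w, w = u + (-(u 2 / v 2)) • v := ⟨_, rfl⟩
    have hvu : herm v u = 0 := by rw [← star_herm, huv, star_zero]
    have w2 : w 2 = 0 := by rw [hw]; simp [h2]
    have hww : herm w w = 0 := by
      rw [hw]
      simp only [herm_add_left, herm_add_right, herm_smul_left, herm_smul_right, hu, hv, huv, hvu]
      simp
    have w1 := null w hww w2
    have hwv : herm w v = 0 := by
      rw [hw, herm_add_left, herm_smul_left, huv, hv]; simp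
    have w0 : w 0 = 0 := by
      rw [hc, w1, w2] at hwv
      simpa [h2] using hwv
    have hw0 : w = 0 := by
      ext i
      fin_cases i
      exacts [w0, w1, w2]
    rw [hw0, neg_smul, ← sub_eq_add_neg] at hw
    exact sub_eq_zero.1 hw.symm

theorem linearIndependent_rep {p q : S3} (h : p ≠ q) :
    LinearIndependent ℂ ![p.1.rep, q.1.rep] := by
  have h1 : p.1 ≠ q.1 := fun h' => h (Subtype.ext h')
  rw [← Projectivization.independent_pair_iff_ne, Projectivization.independent_iff] at h1
  have e : ![p.1.rep, q.1.rep] = Projectivization.rep ∘ ![p.1, q.1] := by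
    ext i : 1
    fin_cases i <;> rfl
  rwa [e]

theorem herm_rep_ne_zero {p q : S3} (h : p ≠ q) : herm p.1.rep q.1.rep ≠ 0 := by
  intro h0
  obtain ⟨k, hk⟩ := exists_smul_eq_of_herm_eq_zero p.2 q.2 h0 q.1.rep_nonzero
  have := LinearIndependent.pair_iff.1 (linearIndependent_rep h) 1 (-k) (by rw [hk]; simp)
  exact one_ne_zero this.1

/-- The determinant of three vectors of `ℂ³`. -/
def det₃ (a b c : Fin 3 → ℂ) : ℂ := (Matrix.of ![a, b, c]).det

theorem det₃_swap_right (a b c : Fin 3 → ℂ) : det₃ a c b = -det₃ a b c := by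
  simp [det₃, Matrix.det_fin_three]; ring

theorem det₃_rotate (a b c : Fin 3 → ℂ) : det₃ b c a = det₃ a b c := by
  simp [det₃, Matrix.det_fin_three]; ring

/-- Cramer's rule writes `det(a,b,c) v` as a combination of `a, b, c` with the determinants through
`v` as coefficients; pairing with the null vector `v` gives zero. -/
theorem det₃_mul_herm {v : Fin 3 → ℂ} (hv : herm v v = 0) (a b c : Fin 3 → ℂ) :
    det₃ v a b * herm c v - det₃ v a c * herm b v + det₃ v b c * herm a v = 0 := by
  have : det₃ v a b * herm c v - det₃ v a c * herm b v + det₃ v b c * herm a v =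
      det₃ a b c * herm v v := by
    simp [det₃, Matrix.det_fin_three, herm, J, Matrix.mulVec, dotProduct, Fin.sum_univ_three]
    ring
  rw [this, hv, mul_zero]

/-- Dependent lifts would put the third point in the plane spanned by the first two, and a plane
containing two distinct null lines contains a negative vector, hence cuts out a `ℂ`-circle. -/
theorem IsGeneric.det₃_ne_zero {p : Fin 4 → S3} (hp : IsGeneric p) {i j k : Fin 4} (hij : i ≠ j)
    (hik : i ≠ k) (hjk : j ≠ k) : det₃ (p i).1.rep (p j).1.rep (p k).1.rep ≠ 0 := by
  intro h0
  have hne : p i ≠ p j := fun h => hij (hp.1 h)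
  have hli := linearIndependent_rep hne
  obtain ⟨c, hc0, hc⟩ := Matrix.exists_vecMul_eq_zero_iff.2 h0
  have hc' : c 0 • (p i).1.rep + c 1 • (p j).1.rep + c 2 • (p k).1.rep = 0 := by
    rw [← hc, Matrix.vecMul_eq_sum, Fin.sum_univ_three]
    rfl
  have hc2 : c 2 ≠ 0 := by
    intro h2
    rw [h2, zero_smul, add_zero] at hc'
    obtain ⟨h, h'⟩ := LinearIndependent.pair_iff.1 hli _ _ hc'
    exact hc0 (by ext m; fin_cases m <;> simp [*])
  set W : Submodule ℂ (Fin 3 → ℂ) := Submodule.span ℂ {(p i).1.rep, (p j).1.rep} with hW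
  have hi : (p i).1.rep ∈ W := Submodule.subset_span (by simp)
  have hj : (p j).1.rep ∈ W := Submodule.subset_span (by simp)
  have hk : (p k).1.rep ∈ W := by
    have : (p k).1.rep = (c 2)⁻¹ • -(c 0 • (p i).1.rep + c 1 • (p j).1.rep) := by
      rw [← add_eq_zero_iff_eq_neg'.1 hc', inv_smul_smul₀ hc2]
    rw [this]
    exact W.smul_mem _ (W.neg_mem (W.add_mem (W.smul_mem _ hi) (W.smul_mem _ hj)))
  refine hp.2 {q : S3 | q.1.rep ∈ W} ⟨W, ?_, ?_, rfl⟩ i j k hij hik hjk ⟨hi, hj, hk⟩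
  · have hr : Set.range ![(p i).1.rep, (p j).1.rep] = {(p i).1.rep, (p j).1.rep} := by
      rw [Matrix.range_cons, Matrix.range_cons, Matrix.range_empty, Set.union_empty, Set.insert_eq]
    rw [hW, ← hr, finrank_span_eq_card hli, Fintype.card_fin]
  · have hh := herm_rep_ne_zero hne
    set h := herm (p i).1.rep (p j).1.rep with hh'
    -- The coefficient `-h` makes both mixed terms equal to `-|h|²`, so the vector has square
    -- `-2|h|²`.
    refine ⟨(p i).1.rep + (-h) • (p j).1.rep, W.add_mem hi (W.smul_mem _ hj), ?_⟩
    have hji : herm (p j).1.rep (p i).1.rep = star h := (star_herm _ _).symm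
    rw [herm_add_left, herm_add_right, herm_add_right, herm_smul_left, herm_smul_left,
      herm_smul_right, herm_smul_right, (p i).2, (p j).2, hji, ← hh']
    have : (0 + star (-h) * h + (-h * star h + -h * (star (-h) * 0))).re =
        -(2 * Complex.normSq h) := by
      simp [Complex.normSq_apply]; ring
    rw [this]
    have := Complex.normSq_pos.2 hh
    linarith

/-! ### The invariants of a generic configuration -/

theorem invariant_eq_det₃ (p₁ p₂ p₃ p₄ : S3) :
    invariant p₁ p₂ p₃ p₄ = det₃ p₁.1.rep p₄.1.rep p₂.1.rep * herm p₃.1.rep p₁.1.rep /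
      (det₃ p₁.1.rep p₃.1.rep p₂.1.rep * herm p₄.1.rep p₁.1.rep) :=
  invariant_eq p₁ p₂ p₃ p₄

/-- The determinants cancel. Exchanging the pairs `(p₁, p₂)` and `(p₃, p₄)` conjugates the remaining
cross-ratio, which is the CR equation. -/
theorem invariant_mul_invariant {p₁ p₂ p₃ p₄ : S3}
    (h₃ : det₃ p₁.1.rep p₃.1.rep p₂.1.rep ≠ 0) (h₄ : det₃ p₁.1.rep p₄.1.rep p₂.1.rep ≠ 0) :
    invariant p₁ p₂ p₃ p₄ * invariant p₂ p₁ p₄ p₃ =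
      herm p₃.1.rep p₁.1.rep * herm p₄.1.rep p₂.1.rep /
        (herm p₄.1.rep p₁.1.rep * herm p₃.1.rep p₂.1.rep) := by
  rw [invariant_eq_det₃, invariant_eq_det₃, det₃_rotate p₁.1.rep, det₃_rotate p₁.1.rep,
    det₃_swap_right p₁.1.rep p₃.1.rep, det₃_swap_right p₁.1.rep p₄.1.rep]
  field_simp

/-- The three-term relation `det₃_mul_herm` divided by one of its terms; it yields both the
similarity relation and `z_ij ≠ 1`. -/
theorem one_sub_invariant {p₁ p₂ p₃ p₄ : S3} (hd : det₃ p₁.1.rep p₃.1.rep p₂.1.rep ≠ 0)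
    (hh : herm p₄.1.rep p₁.1.rep ≠ 0) :
    1 - invariant p₁ p₂ p₃ p₄ = det₃ p₁.1.rep p₃.1.rep p₄.1.rep * herm p₂.1.rep p₁.1.rep /
      (det₃ p₁.1.rep p₃.1.rep p₂.1.rep * herm p₄.1.rep p₁.1.rep) := by
  have h := det₃_mul_herm p₁.2 p₂.1.rep p₃.1.rep p₄.1.rep
  rw [invariant_eq_det₃, eq_div_iff (mul_ne_zero hd hh), sub_mul,
    div_mul_cancel₀ _ (mul_ne_zero hd hh), det₃_swap_right _ p₂.1.rep p₃.1.rep,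
    det₃_swap_right _ p₂.1.rep p₄.1.rep]
  linear_combination -h

theorem edgeInvariant_perm (p : Fin 4 → S3) (σ : Equiv.Perm (Fin 4))
    (hσ : Equiv.Perm.sign σ = 1) :
    edgeInvariant p (σ 0) (σ 1) = invariant (p (σ 0)) (p (σ 1)) (p (σ 2)) (p (σ 3)) := by
  have key : ∀ σ : Equiv.Perm (Fin 4), Equiv.Perm.sign σ = 1 → (σ 0, σ 1, σ 2, σ 3) ∈
      ([(0, 1, 2, 3), (0, 2, 3, 1), (0, 3, 1, 2), (1, 0, 3, 2), (1, 3, 2, 0), (1, 2, 0, 3),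
        (2, 3, 0, 1), (2, 0, 1, 3), (2, 1, 3, 0), (3, 2, 1, 0), (3, 1, 0, 2), (3, 0, 2, 1)] :
        List (Fin 4 × Fin 4 × Fin 4 × Fin 4)) := by decide
  have h := key σ hσ
  generalize σ 0 = i at *
  generalize σ 1 = j at *
  generalize σ 2 = k at *
  generalize σ 3 = l at *
  simp only [List.mem_cons, Prod.mk.injEq, List.not_mem_nil, or_false] at h
  rcases h with h | h | h | h | h | h | h | h | h | h | h | h <;>
    obtain ⟨rfl, rfl, rfl, rfl⟩ := h <;> rfl

theorem IsGeneric.isCRCrossRatio {p : Fin 4 → S3} (hp : IsGeneric p) :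
    IsCRCrossRatio (edgeInvariant p) := by
  have hh : ∀ i j : Fin 4, i ≠ j → herm (p i).1.rep (p j).1.rep ≠ 0 :=
    fun i j hij => herm_rep_ne_zero fun h => hij (hp.1 h)
  have hd : ∀ i j k : Fin 4, i ≠ j → i ≠ k → j ≠ k →
      det₃ (p i).1.rep (p j).1.rep (p k).1.rep ≠ 0 := fun i j k => hp.det₃_ne_zero
  have ne : ∀ (σ : Equiv.Perm (Fin 4)) {a b : Fin 4}, a ≠ b → σ a ≠ σ b :=
    fun σ a b h => σ.injective.ne h
  have ex : ∀ i j : Fin 4, i ≠ j → ∃ σ : Equiv.Perm (Fin 4), Equiv.Perm.sign σ = 1 ∧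
      σ 0 = i ∧ σ 1 = j := by decide
  have sg : ∀ (σ τ : Equiv.Perm (Fin 4)), Equiv.Perm.sign σ = 1 → Equiv.Perm.sign τ = 1 →
      Equiv.Perm.sign (σ * τ) = 1 := by
    intro σ τ h h'; rw [Equiv.Perm.sign_mul, h, h', one_mul]
  refine ⟨?_, ?_, ?_, ?_⟩
  · intro i j hij
    obtain ⟨σ, hσ, rfl, rfl⟩ := ex i j hij
    rw [edgeInvariant_perm p σ hσ, invariant_eq_det₃]
    refine div_ne_zero (mul_ne_zero (hd _ _ _ ?_ ?_ ?_) (hh _ _ ?_))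
      (mul_ne_zero (hd _ _ _ ?_ ?_ ?_) (hh _ _ ?_)) <;> exact ne σ (by decide)
  · intro i j hij h1
    obtain ⟨σ, hσ, rfl, rfl⟩ := ex i j hij
    have h := one_sub_invariant (p₁ := p (σ 0)) (p₂ := p (σ 1)) (p₃ := p (σ 2)) (p₄ := p (σ 3))
      (hd _ _ _ (ne σ (by decide)) (ne σ (by decide)) (ne σ (by decide)))
      (hh _ _ (ne σ (by decide)))
    rw [← edgeInvariant_perm p σ hσ, h1, sub_self] at h
    refine absurd h.symm (div_ne_zero (mul_ne_zero (hd _ _ _ ?_ ?_ ?_) (hh _ _ ?_))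
      (mul_ne_zero (hd _ _ _ ?_ ?_ ?_) (hh _ _ ?_))) <;> exact ne σ (by decide)
  · intro σ hσ
    have h2 := edgeInvariant_perm p (σ * c[1, 2, 3]) (sg σ _ hσ (by decide))
    simp only [Equiv.Perm.mul_apply, show c[(1 : Fin 4), 2, 3] 0 = 0 by decide,
      show c[(1 : Fin 4), 2, 3] 1 = 2 by decide, show c[(1 : Fin 4), 2, 3] 2 = 3 by decide,
      show c[(1 : Fin 4), 2, 3] 3 = 1 by decide] at h2
    rw [h2, edgeInvariant_perm p σ hσ, one_sub_invariant
      (hd _ _ _ (ne σ (by decide)) (ne σ (by decide)) (ne σ (by decide)))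
      (hh _ _ (ne σ (by decide))), one_div_div, invariant_eq_det₃,
      det₃_swap_right _ (p (σ 2)).1.rep (p (σ 1)).1.rep,
      det₃_swap_right _ (p (σ 2)).1.rep (p (σ 3)).1.rep, neg_mul, neg_mul, neg_div_neg_eq]
  · intro σ hσ
    have hp1 : ∀ q : Equiv.Perm (Fin 4), Equiv.Perm.sign q = 1 →
        edgeInvariant p (σ (q 0)) (σ (q 1)) =
        invariant (p (σ (q 0))) (p (σ (q 1))) (p (σ (q 2))) (p (σ (q 3))) :=
      fun q hq => edgeInvariant_perm p (σ * q) (sg σ _ hσ hq)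
    have e1 : edgeInvariant p (σ 0) (σ 1) = _ := edgeInvariant_perm p σ hσ
    have e2 : edgeInvariant p (σ 1) (σ 0) =
      invariant (p (σ 1)) (p (σ 0)) (p (σ 3)) (p (σ 2)) := hp1 (c[0, 1] * c[2, 3]) (by decide)
    have e3 : edgeInvariant p (σ 2) (σ 3) =
      invariant (p (σ 2)) (p (σ 3)) (p (σ 0)) (p (σ 1)) := hp1 (c[0, 2] * c[1, 3]) (by decide)
    have e4 : edgeInvariant p (σ 3) (σ 2) =
      invariant (p (σ 3)) (p (σ 2)) (p (σ 1)) (p (σ 0)) := hp1 (c[0, 3] * c[1, 2]) (by decide)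
    have hd' : ∀ a b c : Fin 4, a ≠ b → a ≠ c → b ≠ c →
        det₃ (p (σ a)).1.rep (p (σ b)).1.rep (p (σ c)).1.rep ≠ 0 :=
      fun a b c h h' h'' => hd _ _ _ (ne σ h) (ne σ h') (ne σ h'')
    rw [e1, e2, e3, e4,
      invariant_mul_invariant (hd' _ _ _ (by decide) (by decide) (by decide))
        (hd' _ _ _ (by decide) (by decide) (by decide)),
      invariant_mul_invariant (hd' _ _ _ (by decide) (by decide) (by decide))
        (hd' _ _ _ (by decide) (by decide) (by decide))]
    simp only [star_div₀, star_mul', star_herm]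
    ring

/-! ### Cartan's invariant -/

theorem exp_two_mul_arg {w : ℂ} (hw : w ≠ 0) :
    Complex.exp (2 * Complex.I * (w.arg : ℂ)) = w / star w := by
  have h1 := Complex.norm_mul_exp_arg_mul_I w
  have h2 : (‖w‖ : ℂ) * Complex.exp (-(w.arg * Complex.I)) = star w := by
    have := congrArg star h1
    rw [star_mul'] at this
    rw [← this]
    congr 1
    · exact (Complex.conj_ofReal _).symm
    · change _ = (starRingEnd ℂ) _
      rw [← Complex.exp_conj, map_mul, Complex.conj_ofReal, Complex.conj_I, mul_neg]
  have hn : (‖w‖ : ℂ) ≠ 0 := by simpa using hw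
  rw [← h2]
  nth_rewrite 2 [← h1]
  rw [mul_div_mul_left _ _ hn, ← Complex.exp_sub]
  congr 1
  ring

theorem exp_cartan {p q r : S3} (hpq : p ≠ q) (hqr : q ≠ r) (hrp : r ≠ p) :
    -Complex.exp (2 * Complex.I * (cartan p q r : ℂ)) =
      -(herm p.1.rep q.1.rep * herm q.1.rep r.1.rep * herm r.1.rep p.1.rep /
        (herm q.1.rep p.1.rep * herm r.1.rep q.1.rep * herm p.1.rep r.1.rep)) := by
  rw [cartan, exp_two_mul_arg (neg_ne_zero.2 (mul_ne_zero (mul_ne_zero (herm_rep_ne_zero hpq)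
    (herm_rep_ne_zero hqr)) (herm_rep_ne_zero hrp)))]
  simp only [star_neg, star_mul', star_herm, neg_div_neg_eq]

/-- Reversing the triangle conjugates the triple Hermitian product. -/
theorem blochWigner_cartan_swap {p q r : S3} (hpq : p ≠ q) (hqr : q ≠ r) (hrp : r ≠ p) :
    blochWigner (-Complex.exp (2 * Complex.I * (cartan p r q : ℂ))) =
      -blochWigner (-Complex.exp (2 * Complex.I * (cartan p q r : ℂ))) := by
  apply blochWigner_of_eq_star
  rw [exp_cartan hpq hqr hrp, exp_cartan hrp.symm hqr.symm hpq.symm]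
  simp only [star_neg, star_div₀, star_mul', star_herm]
  ring

/-- Each determinant occurs once above and once below, up to sign. The signs combine to `-1`, and
the Hermitian products form the ratio of the triple product to its conjugate. -/
theorem IsGeneric.invariant_mul_invariant_mul_invariant {p : Fin 4 → S3} (hp : IsGeneric p)
    {a b c o : Fin 4} (hab : a ≠ b) (hbc : b ≠ c) (hca : c ≠ a) (hao : a ≠ o) (hbo : b ≠ o)
    (hco : c ≠ o) :
    invariant (p a) (p o) (p c) (p b) * invariant (p b) (p o) (p a) (p c) *
        invariant (p c) (p o) (p b) (p a) =
      -Complex.exp (2 * Complex.I * (cartan (p a) (p b) (p c) : ℂ)) := by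
  have ne : ∀ {i j : Fin 4}, i ≠ j → p i ≠ p j := fun h h' => h (hp.1 h')
  rw [exp_cartan (ne hab) (ne hbc) (ne hca)]
  have h1 := hp.det₃_ne_zero hao hab hbo.symm
  have h2 := hp.det₃_ne_zero hao hca.symm hco.symm
  have h3 := hp.det₃_ne_zero hbo hbc hco.symm
  have k1 := herm_rep_ne_zero (ne hab)
  have k2 := herm_rep_ne_zero (ne hab.symm)
  have k3 := herm_rep_ne_zero (ne hbc)
  have k4 := herm_rep_ne_zero (ne hbc.symm)
  have k5 := herm_rep_ne_zero (ne hca)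
  have k6 := herm_rep_ne_zero (ne hca.symm)
  simp only [invariant_eq_det₃]
  have r1 := det₃_swap_right (p a).1.rep (p o).1.rep (p b).1.rep
  have r2 := det₃_swap_right (p a).1.rep (p o).1.rep (p c).1.rep
  have r3 := det₃_swap_right (p b).1.rep (p o).1.rep (p c).1.rep
  have r4 : det₃ (p b).1.rep (p a).1.rep (p o).1.rep =
      -det₃ (p a).1.rep (p b).1.rep (p o).1.rep := by
    rw [det₃_rotate (p o).1.rep, ← det₃_swap_right, det₃_rotate]
  have r5 : det₃ (p c).1.rep (p a).1.rep (p o).1.rep =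
      -det₃ (p a).1.rep (p c).1.rep (p o).1.rep := by
    rw [det₃_rotate (p o).1.rep, ← det₃_swap_right, det₃_rotate]
  have r6 : det₃ (p c).1.rep (p b).1.rep (p o).1.rep =
      -det₃ (p b).1.rep (p c).1.rep (p o).1.rep := by
    rw [det₃_rotate (p o).1.rep, ← det₃_swap_right, det₃_rotate]
  rw [r4, r5, r6, r1, r2, r3]
  field_simp

theorem IsGeneric.two_mul_volume {p : Fin 4 → S3} (hp : IsGeneric p) :
    2 * volume (edgeInvariant p) =
      blochWigner (-Complex.exp (2 * Complex.I * (cartan (p 1) (p 2) (p 3) : ℂ))) -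
      blochWigner (-Complex.exp (2 * Complex.I * (cartan (p 0) (p 2) (p 3) : ℂ))) +
      blochWigner (-Complex.exp (2 * Complex.I * (cartan (p 0) (p 1) (p 3) : ℂ))) -
      blochWigner (-Complex.exp (2 * Complex.I * (cartan (p 0) (p 1) (p 2) : ℂ))) := by
  have ne : ∀ {i j : Fin 4}, i ≠ j → p i ≠ p j := fun h h' => h (hp.1 h')
  have h := hp.isCRCrossRatio.sum_blochWigner
  -- The order of `a, b, c` is dictated by evenness of `(a, o, c, b)`. For `o = 1` and `o = 3` the
  -- resulting triangle has the reverse orientation, which produces the minus signs of the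
  -- coboundary.
  have u0 : edgeInvariant p 1 0 * edgeInvariant p 3 0 * edgeInvariant p 2 0 = _ :=
    (mul_right_comm _ _ _).trans (hp.invariant_mul_invariant_mul_invariant
      (a := 1) (b := 2) (c := 3) (o := 0)
      (by decide) (by decide) (by decide) (by decide) (by decide) (by decide))
  have u1 : edgeInvariant p 0 1 * edgeInvariant p 2 1 * edgeInvariant p 3 1 = _ :=
    (mul_right_comm _ _ _).trans (hp.invariant_mul_invariant_mul_invariant
      (a := 0) (b := 3) (c := 2) (o := 1)
      (by decide) (by decide) (by decide) (by decide) (by decide) (by decide))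
  have u2 : edgeInvariant p 0 2 * edgeInvariant p 1 2 * edgeInvariant p 3 2 = _ :=
    hp.invariant_mul_invariant_mul_invariant (a := 0) (b := 1) (c := 3) (o := 2)
      (by decide) (by decide) (by decide) (by decide) (by decide)
    (by decide)
  have u3 : edgeInvariant p 0 3 * edgeInvariant p 1 3 * edgeInvariant p 2 3 = _ :=
    (mul_right_comm _ _ _).trans (hp.invariant_mul_invariant_mul_invariant
      (a := 0) (b := 2) (c := 1) (o := 3)
      (by decide) (by decide) (by decide) (by decide) (by decide) (by decide))
  rw [u0, u1, u2, u3,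
    blochWigner_cartan_swap (ne (by decide : (0 : Fin 4) ≠ 2)) (ne (by decide : (2 : Fin 4) ≠ 3))
      (ne (by decide : (3 : Fin 4) ≠ 0)),
    blochWigner_cartan_swap (ne (by decide : (0 : Fin 4) ≠ 1)) (ne (by decide : (1 : Fin 4) ≠ 2))
      (ne (by decide : (2 : Fin 4) ≠ 0))] at h
  rw [volume]
  linarith

theorem coboundary_c₂ (o : S3) (g : Fin 4 → PU21) (hg : IsGeneric fun i => g i • o) :
    coboundary (c₂ o) g = volumeCochain o g := by
  have h := hg.two_mul_volume
  have e0 : c₂ o (fun k => g (Fin.succAbove 0 k)) = 1 / 2 * blochWigner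
    (-Complex.exp (2 * Complex.I * (cartan (g 1 • o) (g 2 • o) (g 3 • o) : ℂ))) := rfl
  have e1 : c₂ o (fun k => g (Fin.succAbove 1 k)) = 1 / 2 * blochWigner
    (-Complex.exp (2 * Complex.I * (cartan (g 0 • o) (g 2 • o) (g 3 • o) : ℂ))) := rfl
  have e2 : c₂ o (fun k => g (Fin.succAbove 2 k)) = 1 / 2 * blochWigner
    (-Complex.exp (2 * Complex.I * (cartan (g 0 • o) (g 1 • o) (g 3 • o) : ℂ))) := rfl
  have e3 : c₂ o (fun k => g (Fin.succAbove 3 k)) = 1 / 2 * blochWigner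
    (-Complex.exp (2 * Complex.I * (cartan (g 0 • o) (g 1 • o) (g 2 • o) : ℂ))) := rfl
  rw [coboundary, Fin.sum_univ_four, e0, e1, e2, e3, volumeCochain,
    show ((0 : Fin 4) : ℕ) = 0 from rfl, show ((1 : Fin 4) : ℕ) = 1 from rfl,
    show ((2 : Fin 4) : ℕ) = 2 from rfl, show ((3 : Fin 4) : ℕ) = 3 from rfl]
  linarith

end SphericalCR

end

open SphericalCR
theorem mainTheorem2 :
    (∀ (o : S3) (g : Fin 4 → PU21), IsGeneric (fun i => g i • o) →
      coboundary (c₂ o) g = volumeCochain o g) ∧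
    (∀ p : Fin 4 → S3, IsGeneric p → ∀ z : Fin 4 → Fin 4 → ℂ, z = edgeInvariant p →
      blochWigner (z 1 0 * z 3 0 * z 2 0) + blochWigner (z 0 1 * z 2 1 * z 3 1) +
        blochWigner (z 0 2 * z 1 2 * z 3 2) + blochWigner (z 0 3 * z 1 3 * z 2 3) =
      2 * (blochWigner (z 0 1) + blochWigner (z 1 0) +
        blochWigner (z 2 3) + blochWigner (z 3 2))) ∧
    (∀ z : Fin 4 → Fin 4 → ℂ, IsCRCrossRatio z →
      blochWigner (z 1 0 * z 3 0 * z 2 0) + blochWigner (z 0 1 * z 2 1 * z 3 1) +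
        blochWigner (z 0 2 * z 1 2 * z 3 2) + blochWigner (z 0 3 * z 1 3 * z 2 3) =
      2 * (blochWigner (z 0 1) + blochWigner (z 1 0) +
        blochWigner (z 2 3) + blochWigner (z 3 2))) := by
  refine ⟨coboundary_c₂, ?_, fun z hz => hz.sum_blochWigner⟩
  rintro p hp z rfl
  exact hp.isCRCrossRatio.sum_blochWigner
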